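/- Let $k\in\mathbb N$ and let $(\Lambda,d)$ be a compactly aligned topological $k$-graph. Then its boundary-path groupoid $\mathcal G_\Lambda$ is essentially free if and only if $\Lambda$ satisfies the aperiodicity condition $$\text{(A)}\qquad\text{for every nonempty open } V\subset\Lambda^0 \text{ there is an aperiodic boundary path } x\in\partial\Lambda \text{ with } r(x)\in V.$$ Here the terms have the following meaning. A \emph{topological $k$-graph} is a small category $\Lambda$ with range (codomain) and source (domain) maps $r,s$ and a functor $d:\Lambda\to\mathbb N^k$ such that: the object set $\Lambda^0$ and the morphism set $\Lambda$ are second-countable locally compact Hausdorff spaces; $r,s$ are continuous and $s$ is a local homeomorphism; composition, on the space of composable pairs with the relative product topology, is continuous and open; $d$ is continuous ($\mathbb N^k$ discrete); and whenever $d(\lambda)=m+n$ there is a unique composable pair $(\xi,\eta)$ with $\lambda=\xi\eta$, $d(\xi)=m$, $d(\eta)=n$. Write $\Lambda^m=d^{-1}(m)$, $\vee$ for coordinatewise maximum, $\Lambda*_s\Lambda=\{(\lambda,\mu): s(\lambda)=s(\mu)\}$ and $U*_sV=(U\times V)\cap(\Lambda*_s\Lambda)$. $\Lambda$ is \emph{compactly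 aligned} if for all $p,q\in\mathbb N^k$ and compact $U\subset\Lambda^p$, $V\subset\Lambda^q$, the set $U\Lambda^{(p\vee q)-p}\cap V\Lambda^{(p\vee q)-q}$ is compact. For $m\in(\mathbb N\cup\{\infty\})^k$ let $\Omega_{k,m}$ be the discrete $k$-graph with objects $\{p\in\mathbb N^k:p\le m\}$, morphisms $\{(p,q)\in\mathbb N^k\times\mathbb N^k:p\le q\le m\}$, $r(p,q)=p$, $s(p,q)=q$, $(n,p)(p,q)=(n,q)$ and $d(p,q)=q-p$. The path space $X_\Lambda$ is the set of all continuous degree-preserving functors $x:\Omega_{k,m}\to\Lambda$, $m\in(\mathbb N\cup\{\infty\})^k$; put $d(x)=m$ and $r(x)=x(0)$. For $p\in\mathbb N^k$ with $p\le d(x)$, $\sigma^px\in X_\Lambda$ is the path of degree $d(x)-p$ with $(\sigma^px)(a,b)=x(p+a,p+b)$. For $\lambda\in\Lambda$ with $s(\lambda)=r(x)$, $\lambda x\in X_\Lambda$ is the path with $d(\lambda x)=d(\lambda)+d(x)$, $(\lambda x)(0,d(\lambda))=\lambda$ and $\sigma^{d(\lambda)}(\lambda x)=x$. The path groupoid $G_\Lambda$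 is the set of all $(x,n,y)\in X_\Lambda\times\mathbb Z^k\times X_\Lambda$ for which there are $p,q\in\mathbb N^k$ with $p\le d(x)$, $q\le d(y)$, $p-q=n$ and $\sigma^px=\sigma^qy$, with range $x$, source $y$, product $(x,m,y)(y,n,z)=(x,m+n,z)$ and inverse $(x,n,y)^{-1}=(y,-n,x)$. For $F\subset\Lambda*_s\Lambda$ and $m\in\mathbb Z^k$ put $$Z(F,m)=\{(\lambda x,d(\lambda)-d(\mu),\mu x): (\lambda,\mu)\in F,\ d(\lambda)-d(\mu)=m,\ x\in X_\Lambda,\ r(x)=s(\lambda)\};$$ $G_\Lambda$ carries the topology generated by the sets $Z(U*_sV,m)\setminus Z(F,m)$ with $m\in\mathbb Z^k$, $U,V\subset\Lambda$ open and $F\subset\Lambda*_s\Lambda$ compact. For $\lambda,\mu\in\Lambda$ let $\Lambda^{\min}(\lambda,\mu)=\{(\alpha,\beta):\lambda\alpha=\mu\beta,\ d(\lambda\alpha)=d(\lambda)\vee d(\mu)\}$. For $v\in\Lambda^0$ let $v\mathcal{CE}(\Lambda)$ be the set of compact $E\subset\Lambda$ such that $r(E)$ is a neighbourhood of $v$ and,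 for every $\lambda\in\Lambda$ with $r(\lambda)\in r(E)$, there is $\mu\in E$ with $\Lambda^{\min}(\lambda,\mu)\ne\emptyset$. A path $x\in X_\Lambda$ is a \emph{boundary path} if for all $m\in\mathbb N^k$ with $m\le d(x)$ and all $E\in x(m)\mathcal{CE}(\Lambda)$ there is $\lambda\in E$ with $m+d(\lambda)\le d(x)$ and $x(m,m+d(\lambda))=\lambda$; $\partial\Lambda$ is the set of boundary paths. The boundary-path groupoid $\mathcal G_\Lambda$ is the reduction $G_\Lambda|_{\partial\Lambda}$, the set of elements of $G_\Lambda$ with range and source in $\partial\Lambda$, with the relative topology. A boundary path $x$ is \emph{aperiodic} if $\sigma^px\ne\sigma^qx$ for all $p,q\in\mathbb N^k$ with $p,q\le d(x)$ and $p\ne q$. A groupoid $\Gamma$ with a topology is \emph{essentially free} if $\{x\in\Gamma^{(0)}: x\Gamma x=\{x\}\}$ is dense in the unit space $\Gamma^{(0)}$ (with the relative topology). -/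

import Mathlib

open Topology

universe u v u₁ v₁

/-- A topological `k`-graph `(Λ, d)`: a small category `Λ = (Obj, Mor, r, s)`, with range (codomain)
map `r`, source (domain) map `s` and composition `a b` defined when `s a = r b`, together with a
degree functor `d` to the monoid `ℕ^k` and topologies on `Obj` and `Mor`. -/
structure TopologicalKGraph (k : ℕ) where
  /-- the vertices -/
  Obj : Type u
  /-- the (finite) paths -/
  Mor : Type v
  /-- the range map -/
  r : Mor → Obj
  /-- the source map -/
  s : Mor → Obj
  /-- the identity morphisms -/
  ident : Obj → Mor
  /-- composition of composable pairs -/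
  comp : (a b : Mor) → s a = r b → Mor
  r_ident : ∀ x, r (ident x) = x
  s_ident : ∀ x, s (ident x) = x
  r_comp : ∀ a b (h : s a = r b), r (comp a b h) = r a
  s_comp : ∀ a b (h : s a = r b), s (comp a b h) = s b
  ident_comp : ∀ a, comp (ident (r a)) a (s_ident _) = a
  comp_ident : ∀ a, comp a (ident (s a)) (r_ident _).symm = a
  assoc : ∀ a b c (hab : s a = r b) (hbc : s b = r c),
    comp (comp a b hab) c ((s_comp a b hab).trans hbc)
      = comp a (comp b c hbc) (hab.trans (r_comp b c hbc).symm)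
  /-- the degree map -/
  d : Mor → Fin k → ℕ
  d_ident : ∀ x, d (ident x) = 0
  d_comp : ∀ a b (h : s a = r b), d (comp a b h) = d a + d b
  [topObj : TopologicalSpace Obj]
  [topMor : TopologicalSpace Mor]
  [secondCountableObj : SecondCountableTopology Obj]
  [secondCountableMor : SecondCountableTopology Mor]
  [locallyCompactObj : LocallyCompactSpace Obj]
  [locallyCompactMor : LocallyCompactSpace Mor]
  [hausdorffObj : T2Space Obj]
  [hausdorffMor : T2Space Mor]
  continuous_r : Continuous r
  continuous_s : Continuous s
  isLocalHomeomorph_s : IsLocalHomeomorph s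
  continuous_comp : Continuous fun p : {p : Mor × Mor // s p.1 = r p.2} => comp p.1.1 p.1.2 p.2
  isOpenMap_comp : IsOpenMap fun p : {p : Mor × Mor // s p.1 = r p.2} => comp p.1.1 p.1.2 p.2
  continuous_d : Continuous d
  /-- the factorisation property -/
  factorisation : ∀ (a : Mor) (m n : Fin k → ℕ), d a = m + n →
    ∃! p : Mor × Mor, ∃ h : s p.1 = r p.2, comp p.1 p.2 h = a ∧ d p.1 = m ∧ d p.2 = n

namespace TopologicalKGraph

attribute [instance] topObj topMor secondCountableObj secondCountableMor locallyCompactObj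
  locallyCompactMor hausdorffObj hausdorffMor

variable {k : ℕ}

section Graph

variable (Λ : TopologicalKGraph.{u, v} k)

/-- `Λ^m`, the paths of degree `m`. -/
def paths (m : Fin k → ℕ) : Set Λ.Mor := {a | Λ.d a = m}

/-- `Λ *_s Λ`, the pairs of paths with common source. -/
def sourcePairs : Set (Λ.Mor × Λ.Mor) := {p | Λ.s p.1 = Λ.s p.2}

/-- `U *_s V = (U × V) ∩ (Λ *_s Λ)`. -/
def starS (U V : Set Λ.Mor) : Set (Λ.Mor × Λ.Mor) := (U ×ˢ V) ∩ Λ.sourcePairs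

/-- `U V`, the set of composites `a b` of composable `a ∈ U` and `b ∈ V`. -/
def setComp (U V : Set Λ.Mor) : Set Λ.Mor :=
  {c | ∃ a ∈ U, ∃ b ∈ V, ∃ h : Λ.s a = Λ.r b, Λ.comp a b h = c}

/-- `U ∨ V = U Λ^{(p ∨ q) - p} ∩ V Λ^{(p ∨ q) - q}`, for `U ⊆ Λ^p` and `V ⊆ Λ^q`. -/
def join (p q : Fin k → ℕ) (U V : Set Λ.Mor) : Set Λ.Mor :=
  Λ.setComp U (Λ.paths ((p ⊔ q) - p)) ∩ Λ.setComp V (Λ.paths ((p ⊔ q) - q))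

/-- `Λ^min(a, b)`, the pairs `(α, β)` with `a α = b β` of degree `d a ∨ d b`. -/
def minExt (a b : Λ.Mor) : Set (Λ.Mor × Λ.Mor) :=
  {p | ∃ (h : Λ.s a = Λ.r p.1) (h' : Λ.s b = Λ.r p.2),
    Λ.comp a p.1 h = Λ.comp b p.2 h' ∧ Λ.d (Λ.comp a p.1 h) = Λ.d a ⊔ Λ.d b}

/-- `Λ` is compactly aligned: `U ∨ V` is compact for all compact `U ⊆ Λ^p` and `V ⊆ Λ^q`. -/
def CompactlyAligned : Prop :=
  ∀ (p q : Fin k → ℕ) (U V : Set Λ.Mor), U ⊆ Λ.paths p → V ⊆ Λ.paths q →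
    IsCompact U → IsCompact V → IsCompact (Λ.join p q U V)

/-- `E` is exhaustive for `V`: `E ⊆ V Λ`, and every `a ∈ V Λ` has a minimal common extension with
some `b ∈ E`. -/
def Exhaustive (E : Set Λ.Mor) (V : Set Λ.Obj) : Prop :=
  (∀ b ∈ E, Λ.r b ∈ V) ∧ ∀ a, Λ.r a ∈ V → ∃ b ∈ E, (Λ.minExt a b).Nonempty

/-- `w CE(Λ)`: the compact sets `E` such that `r(E)` is a neighbourhood of `w` and `E` is exhaustive
for `r(E)`. -/
def CE (w : Λ.Obj) : Set (Set Λ.Mor) :=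
  {E | IsCompact E ∧ Λ.r '' E ∈ 𝓝 w ∧ Λ.Exhaustive E (Λ.r '' E)}

end Graph

/-- `p ≤ m`, for `p ∈ ℕ^k` and `m ∈ (ℕ ∪ {∞})^k`. -/
def Below (p : Fin k → ℕ) (m : Fin k → ℕ∞) : Prop := ∀ i, (p i : ℕ∞) ≤ m i

theorem Below.mono {p q : Fin k → ℕ} {m : Fin k → ℕ∞} (hpq : p ≤ q) (hq : Below q m) :
    Below p m := fun i => (Nat.cast_le.mpr (hpq i)).trans (hq i)

theorem below_zero (m : Fin k → ℕ∞) : Below (0 : Fin k → ℕ) m := fun i => by simp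

theorem Below.sub_iff {p q : Fin k → ℕ} {m : Fin k → ℕ∞} (hp : Below p m) :
    Below q (fun i => m i - p i) ↔ Below (p + q) m := by
  refine forall_congr' fun i => ?_
  have h := hp i
  change (q i : ℕ∞) ≤ m i - (p i : ℕ∞) ↔ (((p i + q i : ℕ)) : ℕ∞) ≤ m i
  generalize m i = x at *
  induction x using ENat.recTopCoe with
  | top => simp
  | coe x =>
    norm_cast at *
    omega

/-- The path prototype `Ω_{k,m}`: the objects are the `p ≤ m` in `ℕ^k`, the morphisms the pairs
`(p, q)` with `p ≤ q ≤ m`, with `r (p, q) = p`, `s (p, q) = q`, `(n, p) (p, q) = (n, q)` and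
`d (p, q) = q - p`. The subspace topologies from `ℕ^k` and `ℕ^k × ℕ^k` are the discrete ones. -/
def Omega (k : ℕ) (m : Fin k → ℕ∞) : TopologicalKGraph.{0, 0} k where
  Obj := {p : Fin k → ℕ // Below p m}
  Mor := {p : (Fin k → ℕ) × (Fin k → ℕ) // p.1 ≤ p.2 ∧ Below p.2 m}
  r a := ⟨a.1.1, a.2.2.mono a.2.1⟩
  s a := ⟨a.1.2, a.2.2⟩
  ident p := ⟨(p.1, p.1), le_rfl, p.2⟩
  comp a b h := ⟨(a.1.1, b.1.2),
    (a.2.1.trans (congrArg Subtype.val h).le).trans b.2.1, b.2.2⟩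
  r_ident _ := rfl
  s_ident _ := rfl
  r_comp _ _ _ := rfl
  s_comp _ _ _ := rfl
  ident_comp _ := rfl
  comp_ident _ := rfl
  assoc _ _ _ _ _ := rfl
  d a := a.1.2 - a.1.1
  d_ident _ := by simp
  d_comp a b h := by
    obtain ⟨⟨a₁, a₂⟩, ha, ha'⟩ := a
    obtain ⟨⟨b₁, b₂⟩, hb, hb'⟩ := b
    have h : a₂ = b₁ := congrArg Subtype.val h
    subst h
    funext i
    have h1 := ha i
    have h2 := hb i
    simp only [Pi.sub_apply, Pi.add_apply] at *
    omega
  continuous_r := continuous_of_discreteTopology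
  continuous_s := continuous_of_discreteTopology
  isLocalHomeomorph_s := by
    rw [isLocalHomeomorph_iff_isOpenEmbedding_restrict]
    intro a
    refine ⟨{a}, (isOpen_discrete _).mem_nhds rfl, ?_⟩
    refine .of_continuous_injective_isOpenMap continuous_of_discreteTopology ?_
      fun _ _ => isOpen_discrete _
    rintro ⟨x, rfl⟩ ⟨y, rfl⟩ _
    rfl
  continuous_comp := continuous_of_discreteTopology
  isOpenMap_comp := fun _ _ => isOpen_discrete _
  continuous_d := continuous_of_discreteTopology
  factorisation := by
    rintro ⟨⟨a, b⟩, hab, hb⟩ p q h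
    have h : b - a = p + q := h
    have hi : ∀ i, a i ≤ b i ∧ b i - a i = p i + q i := fun i => ⟨hab i, congrFun h i⟩
    have hc : a + p ≤ b := fun i => by have := hi i; simp only [Pi.add_apply]; omega
    refine ⟨(⟨(a, a + p), fun i => by simp, hb.mono hc⟩, ⟨(a + p, b), hc, hb⟩),
      ⟨rfl, rfl, ?_, ?_⟩, ?_⟩
    · funext i; simp
    · funext i
      have := hi i
      simp only [Pi.sub_apply, Pi.add_apply]
      omega
    · rintro ⟨⟨⟨x, y⟩, hxy, hy⟩, ⟨⟨z, w⟩, hzw, hw⟩⟩ ⟨h1, h2, h3, h4⟩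
      have h1 : y = z := congrArg Subtype.val h1
      have h2 : (x, w) = (a, b) := congrArg Subtype.val h2
      obtain ⟨rfl, rfl⟩ := Prod.mk.inj h2
      subst h1
      have h3 : y - x = p := h3
      have : y = x + p := by
        subst h3
        funext i
        have := hxy i
        simp only [Pi.sub_apply, Pi.add_apply] at *
        omega
      subst this
      rfl

/-- A graph morphism: a continuous degree-preserving functor. -/
@[ext]
structure GraphMorphism (Λ₁ : TopologicalKGraph.{u₁, v₁} k) (Λ₂ : TopologicalKGraph.{u, v} k) where
  /-- the map on objects -/
  obj : Λ₁.Obj → Λ₂.Obj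
  /-- the map on morphisms -/
  mor : Λ₁.Mor → Λ₂.Mor
  continuous_obj : Continuous obj
  continuous_mor : Continuous mor
  map_r : ∀ a, Λ₂.r (mor a) = obj (Λ₁.r a)
  map_s : ∀ a, Λ₂.s (mor a) = obj (Λ₁.s a)
  map_ident : ∀ x, mor (Λ₁.ident x) = Λ₂.ident (obj x)
  map_comp : ∀ a b (h : Λ₁.s a = Λ₁.r b), mor (Λ₁.comp a b h)
    = Λ₂.comp (mor a) (mor b) ((map_s a).trans ((congrArg obj h).trans (map_r b).symm))
  map_d : ∀ a, Λ₂.d (mor a) = Λ₁.d a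

/-- The path space `X_Λ`: the disjoint union over `m ∈ (ℕ ∪ {∞})^k` of the sets of graph morphisms
`Ω_{k,m} → Λ`. -/
structure PathSpace (Λ : TopologicalKGraph.{u, v} k) where
  /-- the degree `d(x)` -/
  degree : Fin k → ℕ∞
  /-- the graph morphism `Ω_{k,d(x)} → Λ` -/
  toMorphism : GraphMorphism (Omega k degree) Λ

section Paths

variable {Λ : TopologicalKGraph.{u, v} k}

namespace PathSpace

/-- The vertex `x(p)`. -/
def vertex (x : Λ.PathSpace) (p : Fin k → ℕ) (hp : Below p x.degree) : Λ.Obj :=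
  x.toMorphism.obj ⟨p, hp⟩

/-- The segment `x(p, q)`. -/
def seg (x : Λ.PathSpace) (p q : Fin k → ℕ) (hpq : p ≤ q) (hq : Below q x.degree) : Λ.Mor :=
  x.toMorphism.mor ⟨(p, q), hpq, hq⟩

/-- The range `r(x) = x(0)`. -/
def range (x : Λ.PathSpace) : Λ.Obj := x.vertex 0 (below_zero _)

/-- The shift `σ^p x`, of degree `d(x) - p`, with `(σ^p x)(a, b) = x(p + a, p + b)`. -/
def shift (x : Λ.PathSpace) (p : Fin k → ℕ) (hp : Below p x.degree) : Λ.PathSpace where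
  degree i := x.degree i - p i
  toMorphism :=
    { obj := fun a => x.vertex (p + a.1) (hp.sub_iff.mp a.2)
      mor := fun a => x.seg (p + a.1.1) (p + a.1.2) (add_le_add_right a.2.1 p)
        (hp.sub_iff.mp a.2.2)
      continuous_obj := continuous_of_discreteTopology (α := {q : Fin k → ℕ // Below q _})
      continuous_mor := continuous_of_discreteTopology
        (α := {q : (Fin k → ℕ) × (Fin k → ℕ) // q.1 ≤ q.2 ∧ Below q.2 _})
      map_r := fun _ => x.toMorphism.map_r _
      map_s := fun _ => x.toMorphism.map_s _
      map_ident := fun a => x.toMorphism.map_ident ⟨p + a.1, hp.sub_iff.mp a.2⟩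
      map_comp := fun a b h => by
        obtain ⟨⟨a₁, a₂⟩, ha, ha'⟩ := a
        obtain ⟨⟨b₁, b₂⟩, hb, hb'⟩ := b
        have h : a₂ = b₁ := congrArg Subtype.val h
        subst h
        exact x.toMorphism.map_comp
          ⟨(p + a₁, p + a₂), add_le_add_right ha p, hp.sub_iff.mp ha'⟩
          ⟨(p + a₂, p + b₂), add_le_add_right hb p, hp.sub_iff.mp hb'⟩ rfl
      map_d := fun a => by
        refine (x.toMorphism.map_d _).trans ?_
        change (p + a.1.2) - (p + a.1.1) = a.1.2 - a.1.1
        funext i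
        exact Nat.add_sub_add_left _ _ _ }

theorem ext_seg {x y : Λ.PathSpace} (hd : x.degree = y.degree)
    (h : ∀ p q hpq hq hq', x.seg p q hpq hq = y.seg p q hpq hq') : x = y := by
  obtain ⟨m, f⟩ := x
  obtain ⟨n, g⟩ := y
  obtain rfl : m = n := hd
  have hmor : f.mor = g.mor := by
    funext a
    exact h a.1.1 a.1.2 a.2.1 a.2.2 a.2.2
  congr
  refine GraphMorphism.ext ?_ hmor
  funext a
  have h1 := f.map_r ((Omega k m).ident a)
  have h2 := g.map_r ((Omega k m).ident a)
  rw [(Omega k m).r_ident] at h1 h2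
  rw [← h1, ← h2, hmor]

theorem shift_shift (x : Λ.PathSpace) (p q : Fin k → ℕ) (hp : Below p x.degree)
    (hq : Below q (x.shift p hp).degree) :
    (x.shift p hp).shift q hq = x.shift (p + q) (hp.sub_iff.mp hq) := by
  refine ext_seg ?_ ?_
  · funext i
    simp [shift, tsub_tsub]
  · intro a b hab hb hb'
    unfold seg
    refine congrArg x.toMorphism.mor (Subtype.ext (Prod.ext ?_ ?_))
    · exact (add_assoc p q a).symm
    · exact (add_assoc p q b).symm

theorem shift_congr {x y : Λ.PathSpace} (hxy : x = y) {p q : Fin k → ℕ} (hpq : p = q)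
    (hp : Below p x.degree) (hq : Below q y.degree) : x.shift p hp = y.shift q hq := by
  subst hxy hpq
  rfl

end PathSpace

/-- `(x, n, y) ∈ G_Λ`: there are `p ≤ d(x)` and `q ≤ d(y)` with `p - q = n` and
`σ^p x = σ^q y`. -/
def Lag (x : Λ.PathSpace) (n : Fin k → ℤ) (y : Λ.PathSpace) : Prop :=
  ∃ (p q : Fin k → ℕ) (hp : Below p x.degree) (hq : Below q y.degree),
    (fun i => (p i : ℤ) - (q i : ℤ)) = n ∧ x.shift p hp = y.shift q hq

theorem Lag.refl (x : Λ.PathSpace) : Lag x 0 x :=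
  ⟨0, 0, below_zero _, below_zero _, by funext i; simp, rfl⟩

theorem Lag.symm {x y : Λ.PathSpace} {n : Fin k → ℤ} (h : Lag x n y) : Lag y (-n) x := by
  obtain ⟨p, q, hp, hq, rfl, e⟩ := h
  exact ⟨q, p, hq, hp, by funext i; simp, e.symm⟩

theorem Lag.trans {x y z : Λ.PathSpace} {m n : Fin k → ℤ} (h : Lag x m y) (h' : Lag y n z) :
    Lag x (m + n) z := by
  obtain ⟨p, q, hp, hq, rfl, e⟩ := h
  obtain ⟨p', q', hp', hq', rfl, e'⟩ := h'
  have h1 : q + (q ⊔ p' - q) = q ⊔ p' := add_tsub_cancel_of_le le_sup_left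
  have h2 : p' + (q ⊔ p' - p') = q ⊔ p' := add_tsub_cancel_of_le le_sup_right
  have ht : Below (q ⊔ p') y.degree := fun i => by
    rcases le_total (q i) (p' i) with hi | hi
    · simpa [hi] using hp' i
    · simpa [hi] using hq i
  have b1 : Below (q ⊔ p' - q) (y.shift q hq).degree := hq.sub_iff.mpr (by rwa [h1])
  have b2 : Below (q ⊔ p' - p') (y.shift p' hp').degree := hp'.sub_iff.mpr (by rwa [h2])
  have b1' : Below (q ⊔ p' - q) (x.shift p hp).degree := by rw [e]; exact b1
  have b2' : Below (q ⊔ p' - p') (z.shift q' hq').degree := by rw [← e']; exact b2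
  refine ⟨p + (q ⊔ p' - q), q' + (q ⊔ p' - p'), hp.sub_iff.mp b1', hq'.sub_iff.mp b2', ?_, ?_⟩
  · funext i
    have i1 := congrFun h1 i
    have i2 := congrFun h2 i
    simp only [Pi.add_apply] at i1 i2 ⊢
    push_cast
    omega
  · rw [← PathSpace.shift_shift x p _ hp b1', ← PathSpace.shift_shift z q' _ hq' b2',
      PathSpace.shift_congr e rfl b1' b1, ← PathSpace.shift_congr e' rfl b2 b2',
      PathSpace.shift_shift, PathSpace.shift_shift]
    exact PathSpace.shift_congr rfl (h1.trans h2.symm) _ _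

/-- The path groupoid `G_Λ`, with object set `X_Λ`. The element `(x, n, y)`, with range `x` and source
`y`, is the arrow `n : y ⟶ x`; products are `(x, m, y) (y, n, z) = (x, m + n, z)` and inverses
`(x, n, y)⁻¹ = (y, -n, x)`. -/
instance pathGroupoid : CategoryTheory.Groupoid.{0} Λ.PathSpace where
  Hom y x := {n : Fin k → ℤ // Lag x n y}
  id x := ⟨0, Lag.refl x⟩
  comp g f := ⟨f.1 + g.1, f.2.trans g.2⟩
  inv f := ⟨-f.1, f.2.symm⟩
  id_comp f := Subtype.ext (add_zero f.1)
  comp_id f := Subtype.ext (zero_add f.1)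
  assoc f g h := Subtype.ext (add_assoc h.1 g.1 f.1).symm
  inv_comp f := Subtype.ext (add_neg_cancel f.1)
  comp_inv f := Subtype.ext (neg_add_cancel f.1)

end Paths

end TopologicalKGraph

/-- An element of a groupoid `C`: an arrow together with its range and its source. -/
structure GroupoidElement (C : Type u) [CategoryTheory.Groupoid.{v} C] where
  /-- the range -/
  range : C
  /-- the source -/
  source : C
  /-- the arrow -/
  arrow : source ⟶ range

namespace GroupoidElement

variable (C : Type u) [CategoryTheory.Groupoid.{v} C]

/-- The unit at an object. -/
def unit {C : Type u} [CategoryTheory.Groupoid.{v} C] (x : C) : GroupoidElement C :=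
  ⟨x, x, CategoryTheory.CategoryStruct.id x⟩

/-- The unit space `Γ⁽⁰⁾`. -/
def units : Set (GroupoidElement C) := Set.range unit

/-- A groupoid with a topology on its set of elements is essentially free: the units `x` with
`x Γ x = {x}` are dense in the unit space (with the relative topology). -/
def EssentiallyFree [TopologicalSpace (GroupoidElement C)] : Prop :=
  Dense {x : units C | {γ : GroupoidElement C | γ.range = x.1.range ∧ γ.source = x.1.range} = {x.1}}

end GroupoidElement

namespace TopologicalKGraph

variable {k : ℕ} {Λ : TopologicalKGraph.{u, v} k}

/-- `y = a x`, the concatenation of a finite path `a` with a path `x`: the initial segment of `y` of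
degree `d(a)` is `a`, and what remains is `x`. -/
def IsConcat (a : Λ.Mor) (x y : Λ.PathSpace) : Prop :=
  ∃ h : Below (Λ.d a) y.degree,
    y.seg 0 (Λ.d a) (fun _ => Nat.zero_le _) h = a ∧ y.shift (Λ.d a) h = x

/-- `Z(F, m)`, the set of all `(a x, d(a) - d(b), b x)` with `(a, b) ∈ F` and
`d(a) - d(b) = m`. -/
def cylinder (F : Set (Λ.Mor × Λ.Mor)) (m : Fin k → ℤ) : Set (GroupoidElement Λ.PathSpace) :=
  {γ | γ.arrow.1 = m ∧ ∃ a b, (a, b) ∈ F ∧ (fun i => (Λ.d a i : ℤ) - (Λ.d b i : ℤ)) = m ∧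
    ∃ x : Λ.PathSpace, IsConcat a x γ.range ∧ IsConcat b x γ.source}

/-- The topology on the path groupoid `G_Λ` generated by the sets `Z(U *_s V, m) ∩ Z(F, m)ᶜ` with `U`,
`V` open in `Λ` and `F ⊆ Λ *_s Λ` compact. -/
instance pathGroupoidTopology : TopologicalSpace (GroupoidElement Λ.PathSpace) :=
  TopologicalSpace.generateFrom
    {S | ∃ (m : Fin k → ℤ) (U V : Set Λ.Mor) (F : Set (Λ.Mor × Λ.Mor)),
      IsOpen U ∧ IsOpen V ∧ F ⊆ Λ.sourcePairs ∧ IsCompact F ∧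
        S = cylinder (Λ.starS U V) m ∩ (cylinder F m)ᶜ}

/-- `x` is a boundary path: for all `m ≤ d(x)` and `E ∈ x(m) CE(Λ)` there is `a ∈ E` with
`x(m, m + d(a)) = a`. -/
def IsBoundaryPath (x : Λ.PathSpace) : Prop :=
  ∀ (m : Fin k → ℕ) (hm : Below m x.degree), ∀ E ∈ Λ.CE (x.vertex m hm),
    ∃ a ∈ E, ∃ h : Below (m + Λ.d a) x.degree,
      x.seg m (m + Λ.d a) (fun _ => Nat.le_add_right _ _) h = a

variable (Λ) in
/-- The set `∂Λ` of boundary paths. -/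
def BoundaryPath : Type (max u v) := {x : Λ.PathSpace // IsBoundaryPath x}

/-- The boundary-path groupoid, the reduction `G_Λ|_{∂Λ}`: its elements are the elements of `G_Λ` with
range and source in `∂Λ`. -/
instance boundaryPathGroupoid : CategoryTheory.Groupoid.{0} Λ.BoundaryPath where
  Hom y x := (y.1 : Λ.PathSpace) ⟶ x.1
  id x := CategoryTheory.CategoryStruct.id x.1
  comp f g := CategoryTheory.CategoryStruct.comp f g
  inv f := CategoryTheory.Groupoid.inv f
  id_comp f := CategoryTheory.Category.id_comp (obj := Λ.PathSpace) f
  comp_id f := CategoryTheory.Category.comp_id (obj := Λ.PathSpace) f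
  assoc f g h := CategoryTheory.Category.assoc (obj := Λ.PathSpace) f g h
  inv_comp f := CategoryTheory.Groupoid.inv_comp (obj := Λ.PathSpace) f
  comp_inv f := CategoryTheory.Groupoid.comp_inv (obj := Λ.PathSpace) f

/-- The inclusion of the boundary-path groupoid into the path groupoid. -/
def boundaryInclusion (γ : GroupoidElement Λ.BoundaryPath) : GroupoidElement Λ.PathSpace :=
  ⟨γ.range.1, γ.source.1, γ.arrow⟩

/-- The boundary-path groupoid has the relative topology of the path groupoid. -/
instance boundaryPathGroupoidTopology : TopologicalSpace (GroupoidElement Λ.BoundaryPath) :=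
  TopologicalSpace.induced boundaryInclusion pathGroupoidTopology

/-- `x` is aperiodic: for `p, q ≤ d(x)`, `p ≠ q` implies `σ^p x ≠ σ^q x`. -/
def Aperiodic (x : Λ.PathSpace) : Prop :=
  ∀ (p q : Fin k → ℕ) (hp : Below p x.degree) (hq : Below q x.degree),
    p ≠ q → x.shift p hp ≠ x.shift q hq

variable (Λ) in
/-- Condition (A): for every nonempty open `V ⊆ Λ⁰` there is an aperiodic boundary path with range
in `V`. -/
def ConditionA : Prop :=
  ∀ V : Set Λ.Obj, IsOpen V → V.Nonempty →
    ∃ x : Λ.PathSpace, IsBoundaryPath x ∧ x.range ∈ V ∧ Aperiodic x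

end TopologicalKGraph

/-!
Initial segments order the finite paths, and an infinite path is the same thing as an ideal of this
order. In these terms the unit space of the path groupoid has the basic open sets `Z(U) \ Z(K)`
with `U` open and `K` compact, where `Z(U)` is the set of paths with an initial segment in `U`, and
a path `x` is a boundary path when every compact set `K` of finite paths that is unavoidable near
some initial segment of `x` contains an initial segment of `x`.

Let a boundary path lie in `Z(U) \ Z(K)`. Then `K` is avoidable near its initial segments, and
compact alignment provides a nonempty open set of finite paths which extend elements of `U` and have
no common extension with an element of `K`. Condition (A) gives an aperiodic boundary path that
continues one of them, and prefixing a finite path preserves both properties; so aperiodic boundary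
paths are dense. For the converse, compactness shows that a maximal ideal is a boundary path, hence
every vertex is the range of a boundary path, which can be approximated by aperiodic ones.
-/

namespace TopologicalKGraph

variable {k : ℕ} {Λ : TopologicalKGraph.{u, v} k}

section InitialSegments

variable {a b c e : Λ.Mor} {m n : Fin k → ℕ}

theorem comp_inj {a' b' : Λ.Mor} {h : Λ.s a = Λ.r b} {h' : Λ.s a' = Λ.r b'}
    (hc : Λ.comp a b h = Λ.comp a' b' h') (hd : Λ.d a = Λ.d a') : a = a' ∧ b = b' := by
  have hd' : Λ.d b' = Λ.d b := by
    have := congrArg Λ.d hc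
    rw [Λ.d_comp, Λ.d_comp, hd] at this
    exact (add_left_cancel this).symm
  exact Prod.mk.inj <| (Λ.factorisation _ _ _ (Λ.d_comp a b h)).unique
    (y₁ := (a, b)) (y₂ := (a', b')) ⟨h, rfl, rfl, rfl⟩ ⟨h', hc.symm, hd.symm, hd'⟩

/-- The order of initial segments: `a ≤ e` when `e = a b` for some path `b`. -/
instance : PartialOrder Λ.Mor where
  le a e := ∃ b, ∃ h : Λ.s a = Λ.r b, Λ.comp a b h = e
  le_refl a := ⟨_, _, Λ.comp_ident a⟩
  le_trans := by
    rintro a _ _ ⟨b, hb, rfl⟩ ⟨c, hc, rfl⟩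
    exact ⟨Λ.comp b c ((Λ.s_comp a b hb).symm.trans hc), _, (Λ.assoc a b c hb _).symm⟩
  le_antisymm := by
    rintro a _ ⟨b, hb, rfl⟩ ⟨c, hc, h⟩
    have hd : Λ.d a = Λ.d (Λ.comp a b hb) := by
      have := congrArg Λ.d h
      rw [Λ.d_comp, Λ.d_comp, add_assoc, add_eq_left] at this
      rw [Λ.d_comp, (add_eq_zero.mp this).1, add_zero]
    exact (comp_inj (h.trans (Λ.comp_ident a).symm) hd.symm).1.symm

theorem le_comp (a b : Λ.Mor) (h : Λ.s a = Λ.r b) : a ≤ Λ.comp a b h := ⟨b, h, rfl⟩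

theorem r_eq_of_le (h : a ≤ e) : Λ.r a = Λ.r e := by
  obtain ⟨b, h, rfl⟩ := h
  exact (Λ.r_comp a b h).symm

theorem d_mono : Monotone Λ.d := by
  rintro a _ ⟨b, h, rfl⟩
  rw [Λ.d_comp]
  exact le_self_add

theorem eq_of_le_of_le (ha : a ≤ e) (hb : b ≤ e) (hd : Λ.d a = Λ.d b) : a = b := by
  obtain ⟨a', h, rfl⟩ := ha
  obtain ⟨b', h', hc⟩ := hb
  exact (comp_inj hc.symm hd).1

theorem comp_le_comp_iff {hb : Λ.s a = Λ.r b} {hc : Λ.s a = Λ.r c} :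
    Λ.comp a b hb ≤ Λ.comp a c hc ↔ b ≤ c := by
  constructor
  · rintro ⟨x, hx, h⟩
    have hx' : Λ.s b = Λ.r x := (Λ.s_comp a b hb).symm.trans hx
    rw [Λ.assoc a b x hb hx'] at h
    exact ⟨x, hx', (comp_inj h rfl).2⟩
  · rintro ⟨x, hx, rfl⟩
    exact ⟨x, (Λ.s_comp a b hb).trans hx, Λ.assoc a b x hb hx⟩

theorem exists_comp_eq_and_d_eq_inf (n : Fin k → ℕ) (c : Λ.Mor) :
    ∃ a b, ∃ h : Λ.s a = Λ.r b, Λ.comp a b h = c ∧ Λ.d a = n ⊓ Λ.d c := by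
  obtain ⟨⟨a, b⟩, ⟨h, hc, ha, -⟩, -⟩ := Λ.factorisation c (n ⊓ Λ.d c) (Λ.d c - n ⊓ Λ.d c)
    (add_tsub_cancel_of_le inf_le_right).symm
  exact ⟨a, b, h, hc, ha⟩

/-- The initial segment `c(0, n ∧ d(c))`. Truncating `n` at `d(c)` makes it total in `n`. -/
noncomputable def initial (n : Fin k → ℕ) (c : Λ.Mor) : Λ.Mor :=
  (exists_comp_eq_and_d_eq_inf n c).choose

/-- The final segment `c(n ∧ d(c), d(c))`, what remains of `c` after `initial n c`. -/
noncomputable def remainder (n : Fin k → ℕ) (c : Λ.Mor) : Λ.Mor :=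
  (exists_comp_eq_and_d_eq_inf n c).choose_spec.choose

theorem s_initial (n : Fin k → ℕ) (c : Λ.Mor) : Λ.s (initial n c) = Λ.r (remainder n c) :=
  (exists_comp_eq_and_d_eq_inf n c).choose_spec.choose_spec.choose

theorem comp_initial_remainder (n : Fin k → ℕ) (c : Λ.Mor) :
    Λ.comp (initial n c) (remainder n c) (s_initial n c) = c :=
  (exists_comp_eq_and_d_eq_inf n c).choose_spec.choose_spec.choose_spec.1

theorem d_initial (n : Fin k → ℕ) (c : Λ.Mor) : Λ.d (initial n c) = n ⊓ Λ.d c :=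
  (exists_comp_eq_and_d_eq_inf n c).choose_spec.choose_spec.choose_spec.2

theorem initial_le (n : Fin k → ℕ) (c : Λ.Mor) : initial n c ≤ c :=
  ⟨_, _, comp_initial_remainder n c⟩

theorem initial_eq_of_le (h : a ≤ c) (hd : Λ.d a = n ⊓ Λ.d c) : initial n c = a :=
  eq_of_le_of_le (initial_le n c) h ((d_initial n c).trans hd.symm)

theorem initial_d_of_le (h : a ≤ c) : initial (Λ.d a) c = a :=
  initial_eq_of_le h (inf_eq_left.mpr (d_mono h)).symm

theorem initial_initial (m n : Fin k → ℕ) (c : Λ.Mor) :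
    initial m (initial n c) = initial (m ⊓ n) c :=
  (initial_eq_of_le ((initial_le m _).trans (initial_le n c))
    (by rw [d_initial, d_initial, inf_assoc])).symm

theorem le_of_le_of_le_of_d_le (ha : a ≤ e) (hb : b ≤ e) (hd : Λ.d a ≤ Λ.d b) : a ≤ b := by
  rw [← initial_d_of_le ha, ← initial_d_of_le hb, ← inf_eq_left.mpr hd, ← initial_initial]
  exact initial_le _ _

theorem le_initial_of_le (ha : a ≤ e) (hd : Λ.d a ≤ n) : a ≤ initial n e :=
  le_of_le_of_le_of_d_le ha (initial_le n e) (d_initial n e ▸ le_inf hd (d_mono ha))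

theorem d_initial_sup (ha : a ≤ e) (hb : b ≤ e) :
    Λ.d (initial (Λ.d a ⊔ Λ.d b) e) = Λ.d a ⊔ Λ.d b := by
  rw [d_initial, inf_eq_left]
  exact sup_le (d_mono ha) (d_mono hb)

theorem comp_eq_iff_of_le {h : Λ.s a = Λ.r b} (hac : a ≤ c) :
    Λ.comp a b h = c ↔ remainder (Λ.d a) c = b := by
  have ha := initial_d_of_le hac
  constructor
  · intro hc
    exact (comp_inj ((comp_initial_remainder _ c).trans hc.symm) (congrArg Λ.d ha)).2
  · rintro rfl
    convert comp_initial_remainder (Λ.d a) c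
    exact ha.symm

theorem remainder_comp (a b : Λ.Mor) (h : Λ.s a = Λ.r b) :
    remainder (Λ.d a) (Λ.comp a b h) = b :=
  (comp_eq_iff_of_le (le_comp a b h)).mp rfl

theorem s_eq_r_remainder (h : a ≤ c) (hn : Λ.d a = n) : Λ.s a = Λ.r (remainder n c) := by
  subst hn
  rw [← s_initial, initial_d_of_le h]

theorem comp_remainder (h : a ≤ c) (hn : Λ.d a = n) :
    Λ.comp a (remainder n c) (s_eq_r_remainder h hn) = c := by
  subst hn
  exact (comp_eq_iff_of_le h).mpr rfl

theorem s_remainder (n : Fin k → ℕ) (c : Λ.Mor) : Λ.s (remainder n c) = Λ.s c := by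
  rw [← Λ.s_comp _ _ (s_initial n c), comp_initial_remainder]

theorem d_remainder (n : Fin k → ℕ) (c : Λ.Mor) : Λ.d (remainder n c) = Λ.d c - n := by
  have h := congrArg Λ.d (comp_initial_remainder n c)
  rw [Λ.d_comp, d_initial] at h
  funext i
  have hi := congrFun h i
  simp only [Pi.add_apply, Pi.inf_apply, Pi.sub_apply] at hi ⊢
  lia

theorem comp_remainder_remainder (hab : a ≤ b) (hbc : b ≤ c) (hm : Λ.d a = m)
    (hn : Λ.d b = n) :
    Λ.comp (remainder m b) (remainder n c)
      ((s_remainder m b).trans (s_eq_r_remainder hbc hn)) = remainder m c := by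
  have h := Λ.assoc a (remainder m b) (remainder n c) (s_eq_r_remainder hab hm)
    ((s_remainder m b).trans (s_eq_r_remainder hbc hn))
  simp only [comp_remainder hab hm, comp_remainder hbc hn] at h
  exact (comp_inj (h.symm.trans (comp_remainder (hab.trans hbc) hm).symm) rfl).2

/-- The paths `a` and `b` are initial segments of a common path. -/
def HasCommonExt (a b : Λ.Mor) : Prop := ∃ e, a ≤ e ∧ b ≤ e

theorem HasCommonExt.exists_d_eq_sup (h : HasCommonExt a b) :
    ∃ e, a ≤ e ∧ b ≤ e ∧ Λ.d e = Λ.d a ⊔ Λ.d b := by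
  obtain ⟨f, ha, hb⟩ := h
  exact ⟨_, le_initial_of_le ha le_sup_left, le_initial_of_le hb le_sup_right,
    d_initial_sup ha hb⟩

theorem minExt_nonempty_iff : (Λ.minExt a b).Nonempty ↔ HasCommonExt a b := by
  constructor
  · rintro ⟨⟨x, y⟩, h, h', hc, -⟩
    exact ⟨_, ⟨x, h, rfl⟩, ⟨y, h', hc.symm⟩⟩
  · intro h
    obtain ⟨_, ⟨x, hx, rfl⟩, ⟨y, hy, hc⟩, hd⟩ := h.exists_d_eq_sup
    exact ⟨(x, y), hx, hy, hc.symm, hd⟩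

end InitialSegments

section Topology

variable {U V K L : Set Λ.Mor}

theorem isOpen_paths (n : Fin k → ℕ) : IsOpen (Λ.paths n) :=
  (isOpen_discrete {n}).preimage Λ.continuous_d

theorem image_comp_preimage_prod (U V : Set Λ.Mor) :
    (fun p : {p : Λ.Mor × Λ.Mor // Λ.s p.1 = Λ.r p.2} => Λ.comp p.1.1 p.1.2 p.2) ''
      (Subtype.val ⁻¹' (U ×ˢ V)) = Λ.setComp U V := by
  ext c
  constructor
  · rintro ⟨⟨⟨a, b⟩, h⟩, ⟨ha, hb⟩, rfl⟩
    exact ⟨a, ha, b, hb, h, rfl⟩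
  · rintro ⟨a, ha, b, hb, h, rfl⟩
    exact ⟨⟨(a, b), h⟩, ⟨ha, hb⟩, rfl⟩

theorem isOpen_setComp (hU : IsOpen U) (hV : IsOpen V) : IsOpen (Λ.setComp U V) := by
  rw [← image_comp_preimage_prod]
  exact Λ.isOpenMap_comp _ ((hU.prod hV).preimage continuous_subtype_val)

theorem isCompact_setComp (hK : IsCompact K) (hL : IsCompact L) :
    IsCompact (Λ.setComp K L) := by
  have hcl : IsClosed {p : Λ.Mor × Λ.Mor | Λ.s p.1 = Λ.r p.2} :=
    isClosed_eq (Λ.continuous_s.comp continuous_fst) (Λ.continuous_r.comp continuous_snd)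
  rw [← image_comp_preimage_prod]
  exact (hcl.isClosedEmbedding_subtypeVal.isCompact_preimage (hK.prod hL)).image
    Λ.continuous_comp

theorem setComp_univ (U : Set Λ.Mor) : Λ.setComp U Set.univ = upperClosure U := by
  ext c
  constructor
  · rintro ⟨a, ha, b, -, h, rfl⟩
    exact ⟨a, ha, le_comp a b h⟩
  · rintro ⟨a, ha, b, h, rfl⟩
    exact ⟨a, ha, b, trivial, h, rfl⟩

theorem isOpen_upperClosure (hU : IsOpen U) : IsOpen (upperClosure U : Set Λ.Mor) := by
  rw [← setComp_univ]
  exact isOpen_setComp hU isOpen_univ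

theorem eventually_initial_mem_and_remainder_mem {n : Fin k → ℕ} {c : Λ.Mor}
    (hU : U ∈ 𝓝 (initial n c)) (hV : V ∈ 𝓝 (remainder n c)) :
    ∀ᶠ c' in 𝓝 c, initial n c' ∈ U ∧ remainder n c' ∈ V := by
  obtain ⟨U', hUU', hU'o, hU'⟩ := mem_nhds_iff.mp hU
  obtain ⟨V', hVV', hV'o, hV'⟩ := mem_nhds_iff.mp hV
  have hopen : IsOpen (Λ.setComp (U' ∩ Λ.paths (n ⊓ Λ.d c)) V') :=
    isOpen_setComp (hU'o.inter (isOpen_paths _)) hV'o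
  filter_upwards [(isOpen_paths (Λ.d c)).mem_nhds rfl, hopen.mem_nhds
    ⟨_, ⟨hU', d_initial n c⟩, _, hV', s_initial n c, comp_initial_remainder n c⟩]
  rintro c' (hd : Λ.d c' = Λ.d c) ⟨a, ⟨ha, hda⟩, b, hb, h, hc'⟩
  have := comp_inj ((comp_initial_remainder n c').trans hc'.symm)
    (by rw [d_initial, hd]; exact hda.symm)
  rw [this.1, this.2]
  exact ⟨hUU' ha, hVV' hb⟩

theorem continuous_initial (n : Fin k → ℕ) : Continuous (initial n : Λ.Mor → Λ.Mor) :=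
  continuous_iff_continuousAt.mpr fun _ _ hU =>
    (eventually_initial_mem_and_remainder_mem hU Filter.univ_mem).mono fun _ => And.left

theorem continuous_remainder (n : Fin k → ℕ) : Continuous (remainder n : Λ.Mor → Λ.Mor) :=
  continuous_iff_continuousAt.mpr fun _ _ hV =>
    (eventually_initial_mem_and_remainder_mem Filter.univ_mem hV).mono fun _ => And.right

/-- The minimal common extensions of an element of `U` and an element of `V`. For `U ⊆ Λ^p` and
`V ⊆ Λ^q` this is `join p q U V`. -/
def minimalExtensions (U V : Set Λ.Mor) : Set Λ.Mor :=
  {e | ∃ a ∈ U, ∃ b ∈ V, a ≤ e ∧ b ≤ e ∧ Λ.d e = Λ.d a ⊔ Λ.d b}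

theorem initial_sup_mem_minimalExtensions {a b e : Λ.Mor} (ha : a ∈ U) (hb : b ∈ V)
    (hae : a ≤ e) (hbe : b ≤ e) : initial (Λ.d a ⊔ Λ.d b) e ∈ minimalExtensions U V :=
  ⟨a, ha, b, hb, le_initial_of_le hae le_sup_left, le_initial_of_le hbe le_sup_right,
    d_initial_sup hae hbe⟩

theorem mem_setComp_paths_sub_iff {p m : Fin k → ℕ} (hU : U ⊆ Λ.paths p) (hpm : p ≤ m)
    {e : Λ.Mor} :
    e ∈ Λ.setComp U (Λ.paths (m - p)) ↔ Λ.d e = m ∧ e ∈ upperClosure U := by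
  constructor
  · rintro ⟨a, ha, b, hb, h, rfl⟩
    refine ⟨?_, a, ha, le_comp a b h⟩
    rw [Λ.d_comp, hU ha, hb, add_tsub_cancel_of_le hpm]
  · rintro ⟨rfl, a, ha, b, h, rfl⟩
    refine ⟨a, ha, b, ?_, h, rfl⟩
    change Λ.d b = _
    rw [Λ.d_comp, hU ha, add_tsub_cancel_left]

theorem mem_join_iff {p q : Fin k → ℕ} (hU : U ⊆ Λ.paths p) (hV : V ⊆ Λ.paths q)
    {e : Λ.Mor} :
    e ∈ Λ.join p q U V ↔ Λ.d e = p ⊔ q ∧ e ∈ upperClosure U ∧ e ∈ upperClosure V := by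
  rw [join, Set.mem_inter_iff, mem_setComp_paths_sub_iff hU le_sup_left,
    mem_setComp_paths_sub_iff hV le_sup_right, ← and_and_left]

theorem minimalExtensions_eq_biUnion_join (U V : Set Λ.Mor) :
    minimalExtensions U V = ⋃ p ∈ Λ.d '' U, ⋃ q ∈ Λ.d '' V,
      Λ.join p q (U ∩ Λ.paths p) (V ∩ Λ.paths q) := by
  ext e
  simp only [Set.mem_iUnion, mem_join_iff Set.inter_subset_right Set.inter_subset_right]
  constructor
  · rintro ⟨a, ha, b, hb, hae, hbe, hd⟩
    exact ⟨_, ⟨a, ha, rfl⟩, _, ⟨b, hb, rfl⟩, hd, ⟨a, ⟨ha, rfl⟩, hae⟩, ⟨b, ⟨hb, rfl⟩, hbe⟩⟩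
  · rintro ⟨_, -, _, -, hd, ⟨a, ⟨ha, rfl⟩, hae⟩, ⟨b, ⟨hb, rfl⟩, hbe⟩⟩
    exact ⟨a, ha, b, hb, hae, hbe, hd⟩

theorem CompactlyAligned.isCompact_minimalExtensions (hΛ : Λ.CompactlyAligned)
    (hK : IsCompact K) (hL : IsCompact L) : IsCompact (minimalExtensions K L) := by
  have finite_degrees {K : Set Λ.Mor} (hK : IsCompact K) : (Λ.d '' K).Finite :=
    (hK.image Λ.continuous_d).finite_of_discrete
  have isClosed_paths (n : Fin k → ℕ) : IsClosed (Λ.paths n) :=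
    (isClosed_discrete {n}).preimage Λ.continuous_d
  rw [minimalExtensions_eq_biUnion_join]
  exact (finite_degrees hK).isCompact_biUnion fun p _ =>
    (finite_degrees hL).isCompact_biUnion fun q _ =>
      hΛ p q _ _ Set.inter_subset_right Set.inter_subset_right
        (hK.inter_right (isClosed_paths p)) (hL.inter_right (isClosed_paths q))

theorem CompactlyAligned.isClosed_setOf_hasCommonExt (hΛ : Λ.CompactlyAligned) :
    IsClosed {p : Λ.Mor × Λ.Mor | HasCommonExt p.1 p.2} := by
  refine isClosed_iff_frequently.mpr fun ⟨a, b⟩ hab => ?_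
  obtain ⟨K, hKa, hKd, hK⟩ := local_compact_nhds ((isOpen_paths (Λ.d a)).mem_nhds rfl)
  obtain ⟨L, hLb, hLd, hL⟩ := local_compact_nhds ((isOpen_paths (Λ.d b)).mem_nhds rfl)
  let truncate (e : Λ.Mor) : Λ.Mor × Λ.Mor := (initial (Λ.d a) e, initial (Λ.d b) e)
  have hcompact : IsCompact (truncate '' minimalExtensions K L) :=
    (hΛ.isCompact_minimalExtensions hK hL).image
      ((continuous_initial _).prodMk (continuous_initial _))
  obtain ⟨e, -, he⟩ : (a, b) ∈ truncate '' minimalExtensions K L := by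
    refine isClosed_iff_frequently.mp hcompact.isClosed _ ?_
    refine (hab.and_eventually (prod_mem_nhds hKa hLb)).mono ?_
    rintro ⟨a', b'⟩ ⟨h, ha', hb'⟩
    obtain ⟨e, hae, hbe, hd⟩ := HasCommonExt.exists_d_eq_sup h
    have hea : initial (Λ.d a) e = a' := (hKd ha' : Λ.d a' = Λ.d a) ▸ initial_d_of_le hae
    have heb : initial (Λ.d b) e = b' := (hLd hb' : Λ.d b' = Λ.d b) ▸ initial_d_of_le hbe
    exact ⟨e, ⟨a', ha', b', hb', hae, hbe, hd⟩, Prod.ext hea heb⟩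
  rw [← he]
  exact ⟨e, initial_le _ e, initial_le _ e⟩

theorem CompactlyAligned.isClosed_setOf_exists_hasCommonExt (hΛ : Λ.CompactlyAligned)
    (hK : IsCompact K) : IsClosed {e : Λ.Mor | ∃ b ∈ K, HasCommonExt e b} := by
  have : CompactSpace K := isCompact_iff_compactSpace.mp hK
  convert isClosedMap_fst_of_compactSpace (Y := K) _ (hΛ.isClosed_setOf_hasCommonExt.preimage
    (continuous_id.prodMap continuous_subtype_val))
  ext e
  simp

end Topology

section Ideals

theorem isIdeal_lowerClosure {P : Type*} [Preorder P] {S : Set P} (hne : S.Nonempty)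
    (hS : DirectedOn (· ≤ ·) S) : Order.IsIdeal (lowerClosure S : Set P) where
  IsLowerSet := (lowerClosure S).lower
  Nonempty := hne.mono subset_lowerClosure
  Directed := by
    rintro a ⟨a', ha', ha⟩ b ⟨b', hb', hb⟩
    obtain ⟨c, hc, hac, hbc⟩ := hS a' ha' b' hb'
    exact ⟨c, subset_lowerClosure hc, ha.trans hac, hb.trans hbc⟩

theorem le_of_mem_of_mem {I : Order.Ideal Λ.Mor} {a b : Λ.Mor} (ha : a ∈ I) (hb : b ∈ I)
    (hd : Λ.d a ≤ Λ.d b) : a ≤ b := by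
  obtain ⟨c, -, hac, hbc⟩ := I.directed a ha b hb
  exact le_of_le_of_le_of_d_le hac hbc hd

theorem Below.sup {p q : Fin k → ℕ} {m : Fin k → ℕ∞} (hp : Below p m) (hq : Below q m) :
    Below (p ⊔ q) m := fun i => by
  rcases le_total (p i) (q i) with h | h
  · simpa [h] using hq i
  · simpa [h] using hp i

theorem eq_of_forall_below_iff {m m' : Fin k → ℕ∞} (h : ∀ n, Below n m ↔ Below n m') :
    m = m' := by
  have below_single (m : Fin k → ℕ∞) (i : Fin k) (n : ℕ) : Below (Pi.single i n) m ↔ n ≤ m i := by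
    constructor
    · intro hn
      simpa using hn i
    · intro hn j
      rcases eq_or_ne j i with rfl | hj
      · simpa using hn
      · simp [hj]
  refine funext fun i => le_antisymm ?_ ?_ <;>
    refine ENat.forall_natCast_le_iff_le.mp fun n hn => ?_
  · exact (below_single m' i n).mp ((h _).mp ((below_single m i n).mpr hn))
  · exact (below_single m i n).mp ((h _).mpr ((below_single m' i n).mpr hn))

namespace PathSpace

variable {x y : Λ.PathSpace} {a b : Λ.Mor}

/-- The initial segment `x(0, n)` of a path. -/
def initialSegment (x : Λ.PathSpace) (n : {n : Fin k → ℕ // Below n x.degree}) : Λ.Mor :=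
  x.seg 0 n (fun _ => Nat.zero_le _) n.2

theorem r_seg {p q : Fin k → ℕ} (hpq : p ≤ q) (hq : Below q x.degree) :
    Λ.r (x.seg p q hpq hq) = x.vertex p (hq.mono hpq) := x.toMorphism.map_r _

theorem s_seg {p q : Fin k → ℕ} (hpq : p ≤ q) (hq : Below q x.degree) :
    Λ.s (x.seg p q hpq hq) = x.vertex q hq := x.toMorphism.map_s _

theorem d_initialSegment (x : Λ.PathSpace) (n : {n : Fin k → ℕ // Below n x.degree}) :
    Λ.d (x.initialSegment n) = n := (x.toMorphism.map_d _).trans (tsub_zero n.1)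

theorem comp_initialSegment_seg {p q : Fin k → ℕ} (hpq : p ≤ q) (hq : Below q x.degree) :
    Λ.comp (x.initialSegment ⟨p, hq.mono hpq⟩) (x.seg p q hpq hq)
      ((s_seg _ _).trans (r_seg _ _).symm) = x.initialSegment ⟨q, hq⟩ :=
  (x.toMorphism.map_comp ⟨(0, p), fun _ => Nat.zero_le _, hq.mono hpq⟩ ⟨(p, q), hpq, hq⟩ rfl).symm

theorem monotone_initialSegment (x : Λ.PathSpace) : Monotone x.initialSegment :=
  fun _ q hpq => ⟨_, _, comp_initialSegment_seg hpq q.2⟩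

theorem remainder_initialSegment {p q : Fin k → ℕ} (hpq : p ≤ q) (hq : Below q x.degree) :
    remainder p (x.initialSegment ⟨q, hq⟩) = x.seg p q hpq hq := by
  have := remainder_comp (x.initialSegment ⟨p, hq.mono hpq⟩) (x.seg p q hpq hq)
    ((s_seg _ _).trans (r_seg _ _).symm)
  rwa [comp_initialSegment_seg, d_initialSegment] at this

/-- The set of initial segments of a path, an ideal for the order of initial segments. -/
def ideal (x : Λ.PathSpace) : Order.Ideal Λ.Mor where
  carrier := Set.range x.initialSegment
  lower' := by
    rintro _ a ha ⟨n, rfl⟩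
    have hda : Λ.d a ≤ n := x.d_initialSegment n ▸ d_mono ha
    exact ⟨⟨Λ.d a, n.2.mono hda⟩, eq_of_le_of_le (x.monotone_initialSegment hda) ha
      (x.d_initialSegment _)⟩
  nonempty' := ⟨_, ⟨0, below_zero _⟩, rfl⟩
  directed' := by
    rintro _ ⟨p, rfl⟩ _ ⟨q, rfl⟩
    exact ⟨_, ⟨⟨p.1 ⊔ q.1, p.2.sup q.2⟩, rfl⟩,
      x.monotone_initialSegment (Subtype.coe_le_coe.mp le_sup_left),
      x.monotone_initialSegment (Subtype.coe_le_coe.mp le_sup_right)⟩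

theorem initialSegment_mem (x : Λ.PathSpace) (n : {n : Fin k → ℕ // Below n x.degree}) :
    x.initialSegment n ∈ x.ideal := ⟨n, rfl⟩

theorem below_of_mem (ha : a ∈ x.ideal) : Below (Λ.d a) x.degree := by
  obtain ⟨n, rfl⟩ := ha
  exact (x.d_initialSegment n).symm ▸ n.2

theorem initialSegment_of_mem (ha : a ∈ x.ideal) :
    x.initialSegment ⟨Λ.d a, below_of_mem ha⟩ = a := by
  obtain ⟨n, rfl⟩ := ha
  congr
  exact x.d_initialSegment n

theorem below_iff_exists_mem {n : Fin k → ℕ} :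
    Below n x.degree ↔ ∃ a ∈ x.ideal, Λ.d a = n := by
  constructor
  · exact fun hn => ⟨_, x.initialSegment_mem ⟨n, hn⟩, x.d_initialSegment ⟨n, hn⟩⟩
  · rintro ⟨a, ha, rfl⟩
    exact below_of_mem ha

theorem ident_range_mem (x : Λ.PathSpace) : Λ.ident x.range ∈ x.ideal :=
  ⟨⟨0, below_zero _⟩, x.toMorphism.map_ident ⟨0, below_zero _⟩⟩

theorem r_of_mem (ha : a ∈ x.ideal) : Λ.r a = x.range := by
  rw [← initialSegment_of_mem ha]
  exact r_seg _ _

theorem s_of_mem (ha : a ∈ x.ideal) : Λ.s a = x.vertex (Λ.d a) (below_of_mem ha) := by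
  rw [← s_seg (fun _ => Nat.zero_le _) (below_of_mem ha)]
  exact congrArg Λ.s (initialSegment_of_mem ha).symm

theorem comp_mem_ideal_iff (ha : a ∈ x.ideal) (h : Λ.s a = Λ.r b) :
    Λ.comp a b h ∈ x.ideal ↔ ∃ h' : Below (Λ.d a + Λ.d b) x.degree,
      x.seg (Λ.d a) (Λ.d a + Λ.d b) (fun _ => Nat.le_add_right _ _) h' = b := by
  have comp_eq_iff (h' : Below (Λ.d a + Λ.d b) x.degree) :
      Λ.comp a b h = x.initialSegment ⟨_, h'⟩ ↔
        x.seg (Λ.d a) (Λ.d a + Λ.d b) (fun _ => Nat.le_add_right _ _) h' = b := by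
    rw [← remainder_initialSegment]
    refine comp_eq_iff_of_le (le_of_mem_of_mem ha (x.initialSegment_mem _) ?_)
    exact (x.d_initialSegment _).symm ▸ fun _ => Nat.le_add_right _ _
  constructor
  · intro hab
    have h' : Below (Λ.d a + Λ.d b) x.degree := Λ.d_comp a b h ▸ below_of_mem hab
    refine ⟨h', (comp_eq_iff h').mp ?_⟩
    rw [← initialSegment_of_mem hab]
    congr 2
    exact Λ.d_comp a b h
  · rintro ⟨h', hb⟩
    exact (comp_eq_iff h').mpr hb ▸ x.initialSegment_mem _

theorem ideal_injective : Function.Injective (ideal : Λ.PathSpace → Order.Ideal Λ.Mor) := by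
  intro x y h
  have hdeg : x.degree = y.degree := eq_of_forall_below_iff fun n => by
    rw [below_iff_exists_mem, below_iff_exists_mem, h]
  refine ext_seg hdeg fun p q hpq hq hq' => ?_
  rw [← remainder_initialSegment, ← remainder_initialSegment]
  congr 1
  have hxy : x.initialSegment ⟨q, hq⟩ ∈ y.ideal := h ▸ x.initialSegment_mem _
  rw [← initialSegment_of_mem hxy]
  congr 2
  exact x.d_initialSegment _

theorem mem_ideal_shift_iff (ha : a ∈ x.ideal) (h : Λ.s a = Λ.r b) :
    b ∈ (x.shift (Λ.d a) (below_of_mem ha)).ideal ↔ Λ.comp a b h ∈ x.ideal := by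
  rw [comp_mem_ideal_iff ha h]
  constructor
  · intro hb
    exact ⟨(below_of_mem ha).sub_iff.mp (below_of_mem hb), initialSegment_of_mem hb⟩
  · rintro ⟨h', hb⟩
    exact ⟨⟨Λ.d b, (below_of_mem ha).sub_iff.mpr h'⟩, hb⟩

theorem range_shift (ha : a ∈ x.ideal) :
    (x.shift (Λ.d a) (below_of_mem ha)).range = Λ.s a := (s_of_mem ha).symm

theorem isConcat_iff : IsConcat a x y ↔
    ∃ h : a ∈ y.ideal, y.shift (Λ.d a) (below_of_mem h) = x :=
  ⟨fun ⟨h, ha, hx⟩ => ⟨⟨⟨Λ.d a, h⟩, ha⟩, hx⟩,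
    fun ⟨ha, hx⟩ => ⟨below_of_mem ha, initialSegment_of_mem ha, hx⟩⟩

section OfMonotone

variable {m : Fin k → ℕ∞} (F : {n : Fin k → ℕ // Below n m} → Λ.Mor) (hF : Monotone F)
  (hd : ∀ n, Λ.d (F n) = n)

/-- The path of degree `m` with `x(0, n) = F n`, for a monotone family `F` with `d (F n) = n`. -/
noncomputable def ofMonotone : Λ.PathSpace where
  degree := m
  toMorphism :=
    { obj := fun p => Λ.s (F p)
      mor := fun a => remainder a.1.1 (F ⟨a.1.2, a.2.2⟩)
      continuous_obj := continuous_of_discreteTopology (α := {q : Fin k → ℕ // Below q _})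
      continuous_mor := continuous_of_discreteTopology
        (α := {q : (Fin k → ℕ) × (Fin k → ℕ) // q.1 ≤ q.2 ∧ Below q.2 _})
      map_r := fun a =>
        (s_eq_r_remainder (hF (a := ⟨a.1.1, a.2.2.mono a.2.1⟩) a.2.1) (hd _)).symm
      map_s := fun a => s_remainder _ _
      map_ident := fun p =>
        (comp_inj ((comp_remainder le_rfl (hd p)).trans (Λ.comp_ident (F p)).symm) rfl).2
      map_comp := by
        rintro ⟨⟨p, q⟩, hpq, hq⟩ ⟨⟨q', t⟩, hqt, ht⟩ h
        obtain rfl : q = q' := congrArg Subtype.val h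
        exact (comp_remainder_remainder (hF (a := ⟨p, hq.mono hpq⟩) (b := ⟨q, hq⟩) hpq)
          (hF (a := ⟨q, hq⟩) (b := ⟨t, ht⟩) hqt) (hd _) (hd _)).symm
      map_d := fun a => by rw [d_remainder, hd]; rfl }

theorem initialSegment_ofMonotone : (ofMonotone F hF hd).initialSegment = F := by
  funext n
  change remainder 0 (F n) = F n
  simpa only [Λ.d_ident, Λ.ident_comp] using
    remainder_comp (Λ.ident (Λ.r (F n))) (F n) (Λ.s_ident _)

end OfMonotone

theorem below_iSup_degree_iff (I : Order.Ideal Λ.Mor) {n : Fin k → ℕ} :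
    Below n (fun i => ⨆ a ∈ I, (Λ.d a i : ℕ∞)) ↔ ∃ a ∈ I, Λ.d a = n := by
  constructor
  · intro hn
    have exists_le_apply (i : Fin k) : ∃ a : I, n i ≤ Λ.d a i := by
      rcases Nat.eq_zero_or_pos (n i) with h0 | hpos
      · obtain ⟨a, ha⟩ := I.nonempty
        exact ⟨⟨a, ha⟩, h0.trans_le (Nat.zero_le _)⟩
      · have hlt : ((n i - 1 : ℕ) : ℕ∞) < ⨆ a ∈ I, (Λ.d a i : ℕ∞) :=
          (Nat.cast_lt.mpr (Nat.sub_one_lt hpos.ne')).trans_le (hn i)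
        obtain ⟨a, ha, h⟩ := lt_biSup_iff.mp hlt
        exact ⟨⟨a, ha⟩, Nat.le_of_pred_lt (Nat.cast_lt.mp h)⟩
    choose a ha using exists_le_apply
    have : Nonempty I := I.nonempty.to_subtype
    obtain ⟨c, hc⟩ := (directedOn_iff_directed.mp I.directed).finite_le a
    refine ⟨initial n c, I.lower (initial_le n _) c.2, ?_⟩
    rw [d_initial, inf_eq_left]
    exact fun i => (ha i).trans (d_mono (hc i) i)
  · rintro ⟨a, ha, rfl⟩ i
    exact le_iSup₂ (f := fun a (_ : a ∈ I) => (Λ.d a i : ℕ∞)) a ha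

theorem ideal_surjective : Function.Surjective (ideal : Λ.PathSpace → Order.Ideal Λ.Mor) := by
  intro I
  have exists_mem_d_eq (n : {n : Fin k → ℕ // Below n fun i => ⨆ a ∈ I, (Λ.d a i : ℕ∞)}) :
      ∃ a ∈ I, Λ.d a = n := (below_iSup_degree_iff I).mp n.2
  choose F hFI hFd using exists_mem_d_eq
  have hF : Monotone F := fun p q hpq =>
    le_of_mem_of_mem (hFI p) (hFI q) (by rw [hFd, hFd]; exact hpq)
  refine ⟨ofMonotone F hF hFd, Order.Ideal.ext ?_⟩
  change Set.range (ofMonotone F hF hFd).initialSegment = I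
  rw [initialSegment_ofMonotone]
  refine subset_antisymm (Set.range_subset_iff.mpr hFI) fun a ha => ?_
  have hda := hFd ⟨Λ.d a, (below_iSup_degree_iff I).mpr ⟨a, ha, rfl⟩⟩
  exact ⟨_, le_antisymm (le_of_mem_of_mem (hFI _) ha hda.le) (le_of_mem_of_mem ha (hFI _) hda.ge)⟩

theorem exists_isConcat (a : Λ.Mor) (x : Λ.PathSpace) (h : Λ.s a = x.range) :
    ∃ y, IsConcat a x y := by
  have s_eq (b : x.ideal) : Λ.s a = Λ.r b.1 := h.trans (r_of_mem b.2).symm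
  have hI : Order.IsIdeal (lowerClosure (Set.range fun b => Λ.comp a b.1 (s_eq b)) : Set Λ.Mor) :=
    isIdeal_lowerClosure ⟨_, ⟨_, x.ident_range_mem⟩, rfl⟩ <| by
      rintro _ ⟨b, rfl⟩ _ ⟨c, rfl⟩
      obtain ⟨e, he, hbe, hce⟩ := x.ideal.directed b.1 b.2 c.1 c.2
      exact ⟨_, ⟨⟨e, he⟩, rfl⟩, comp_le_comp_iff.mpr hbe, comp_le_comp_iff.mpr hce⟩
  obtain ⟨y, hy⟩ := ideal_surjective hI.toIdeal
  have mem_iff (c : Λ.Mor) : c ∈ y.ideal ↔ ∃ b : x.ideal, c ≤ Λ.comp a b.1 (s_eq b) := by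
    rw [hy, Order.Ideal.mem_toIdeal, SetLike.mem_coe, mem_lowerClosure, Set.exists_range_iff]
  have ha : a ∈ y.ideal := (mem_iff a).mpr ⟨⟨_, x.ident_range_mem⟩, le_comp _ _ _⟩
  refine ⟨y, isConcat_iff.mpr ⟨ha, ideal_injective (SetLike.ext fun b => ?_)⟩⟩
  constructor
  · intro hb
    have hab : Λ.s a = Λ.r b := by rw [r_of_mem hb, range_shift ha]
    obtain ⟨c, hc⟩ := (mem_iff _).mp ((mem_ideal_shift_iff ha hab).mp hb)
    exact x.ideal.lower (comp_le_comp_iff.mp hc) c.2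
  · intro hb
    exact (mem_ideal_shift_iff ha (s_eq ⟨b, hb⟩)).mpr ((mem_iff _).mpr ⟨⟨b, hb⟩, le_rfl⟩)

end PathSpace

end Ideals

section Boundary

variable {x : Λ.PathSpace} {a b c : Λ.Mor} {E K U : Set Λ.Mor}

/-- The condition that membership in the boundary `∂Λ` imposes on a path `x` at its vertex
`x(d(a)) = s(a)`, where `a` is an initial segment of `x`. -/
def IsBoundaryAt (x : Λ.PathSpace) (a : Λ.Mor) : Prop :=
  ∀ E ∈ Λ.CE (Λ.s a), ∃ b ∈ E, ∃ h : Λ.s a = Λ.r b, Λ.comp a b h ∈ x.ideal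

theorem isBoundaryPath_iff : IsBoundaryPath x ↔ ∀ a ∈ x.ideal, IsBoundaryAt x a := by
  constructor
  · intro hx a ha E hE
    rw [PathSpace.s_of_mem ha] at hE
    obtain ⟨b, hb, h, hseg⟩ := hx _ _ E hE
    have hab : Λ.s a = Λ.r b := by rw [PathSpace.s_of_mem ha, ← hseg, PathSpace.r_seg]
    exact ⟨b, hb, hab, (PathSpace.comp_mem_ideal_iff ha hab).mpr ⟨h, hseg⟩⟩
  · intro hx m hm E hE
    obtain ⟨a, ha, rfl⟩ := PathSpace.below_iff_exists_mem.mp hm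
    rw [← PathSpace.s_of_mem ha] at hE
    obtain ⟨b, hb, hab, hmem⟩ := hx a ha E hE
    exact ⟨b, hb, (PathSpace.comp_mem_ideal_iff ha hab).mp hmem⟩

/-- Every extension of a path close to `a` has a common extension with an element of `K`. This
replaces the exhaustive sets at `s(a)` by sets of paths which start at the same vertex as `a`. -/
def UnavoidableNear (K : Set Λ.Mor) (a : Λ.Mor) : Prop :=
  ∀ᶠ c in 𝓝 a, ∀ e, c ≤ e → ∃ b ∈ K, HasCommonExt e b

theorem UnavoidableNear.of_le (h : UnavoidableNear K a) (hac : a ≤ c) : UnavoidableNear K c := by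
  have htendsto : Filter.Tendsto (initial (Λ.d a)) (𝓝 c) (𝓝 a) := by
    simpa only [initial_d_of_le hac] using (continuous_initial (Λ.d a)).tendsto c
  exact (htendsto.eventually h).mono fun c' hc' e hce => hc' e ((initial_le _ c').trans hce)

theorem image_r_image_remainder_minimalExtensions {p : Fin k → ℕ} (hU : U ⊆ Λ.paths p)
    (h : ∀ c ∈ U, ∃ b ∈ K, HasCommonExt c b) :
    Λ.r '' (remainder p '' minimalExtensions U K) = Λ.s '' U := by
  ext w
  constructor
  · rintro ⟨_, ⟨e, ⟨c, hc, -, -, hce, -⟩, rfl⟩, rfl⟩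
    exact ⟨c, hc, s_eq_r_remainder hce (hU hc)⟩
  · rintro ⟨c, hc, rfl⟩
    obtain ⟨b, hb, hcb⟩ := h c hc
    obtain ⟨e, hce, hbe, hd⟩ := hcb.exists_d_eq_sup
    exact ⟨_, ⟨e, ⟨c, hc, b, hb, hce, hbe, hd⟩, rfl⟩, (s_eq_r_remainder hce (hU hc)).symm⟩

theorem exhaustive_image_remainder_minimalExtensions {p : Fin k → ℕ} (hU : U ⊆ Λ.paths p)
    (h : ∀ c ∈ U, ∀ e, c ≤ e → ∃ b ∈ K, HasCommonExt e b) :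
    Λ.Exhaustive (remainder p '' minimalExtensions U K) (Λ.s '' U) := by
  constructor
  · rintro _ ⟨e, ⟨c, hc, -, -, hce, -⟩, rfl⟩
    exact ⟨c, hc, s_eq_r_remainder hce (hU hc)⟩
  · rintro γ ⟨c, hc, hγ⟩
    obtain ⟨b, hb, f, hγf, hbf⟩ := h c hc _ (le_comp c γ hγ)
    have hcf : c ≤ f := (le_comp c γ hγ).trans hγf
    have hmin := initial_sup_mem_minimalExtensions hc hb hcf hbf
    refine ⟨_, ⟨_, hmin, rfl⟩, minExt_nonempty_iff.mpr ⟨remainder p f, ?_, ?_⟩⟩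
    · rwa [← comp_le_comp_iff (hb := hγ) (hc := s_eq_r_remainder hcf (hU hc)),
        comp_remainder hcf (hU hc)]
    · have hce := le_initial_of_le hcf (le_sup_left (b := Λ.d b))
      rw [← comp_le_comp_iff (hb := s_eq_r_remainder hce (hU hc))
        (hc := s_eq_r_remainder hcf (hU hc)), comp_remainder hce (hU hc),
        comp_remainder hcf (hU hc)]
      exact initial_le _ f

theorem CompactlyAligned.image_remainder_minimalExtensions_mem_CE (hΛ : Λ.CompactlyAligned)
    (hUc : IsCompact U) (hU : U ∈ 𝓝 a) (hUd : U ⊆ Λ.paths (Λ.d a)) (hK : IsCompact K)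
    (h : ∀ c ∈ U, ∀ e, c ≤ e → ∃ b ∈ K, HasCommonExt e b) :
    remainder (Λ.d a) '' minimalExtensions U K ∈ Λ.CE (Λ.s a) := by
  have hr := image_r_image_remainder_minimalExtensions hUd fun c hc => h c hc c le_rfl
  refine ⟨(hΛ.isCompact_minimalExtensions hUc hK).image (continuous_remainder _), ?_, ?_⟩
  · rw [hr]
    exact Λ.isLocalHomeomorph_s.isOpenMap.image_mem_nhds hU
  · rw [hr]
    exact exhaustive_image_remainder_minimalExtensions hUd h

theorem exists_mem_setComp_hasCommonExt {e : Λ.Mor} (hE : Λ.Exhaustive E (Λ.r '' E)) (ha : a ∈ U)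
    (hs : Λ.s a ∈ Λ.r '' E) (hae : a ≤ e) : ∃ b ∈ Λ.setComp U E, HasCommonExt e b := by
  obtain ⟨γ, hγ, rfl⟩ := hae
  obtain ⟨b, hb, hγb⟩ := hE.2 γ (hγ ▸ hs)
  obtain ⟨f, hγf, hbf⟩ := minExt_nonempty_iff.mp hγb
  have haf : Λ.s a = Λ.r f := hγ.trans (r_eq_of_le hγf)
  have hab : Λ.s a = Λ.r b := haf.trans (r_eq_of_le hbf).symm
  exact ⟨Λ.comp a b hab, ⟨a, ha, b, hb, hab, rfl⟩, Λ.comp a f haf, comp_le_comp_iff.mpr hγf,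
    comp_le_comp_iff.mpr hbf⟩

theorem IsBoundaryAt.exists_mem_ideal (hΛ : Λ.CompactlyAligned) (hx : IsBoundaryAt x a)
    (hK : IsCompact K) (h : UnavoidableNear K a) : ∃ b ∈ K, b ∈ x.ideal := by
  obtain ⟨φ, haφ, hφ⟩ := Λ.isLocalHomeomorph_s a
  obtain ⟨U, hU, hUs, hUc⟩ := local_compact_nhds
    (Filter.inter_mem (Filter.inter_mem h (φ.open_source.mem_nhds haφ))
      ((isOpen_paths (Λ.d a)).mem_nhds rfl))
  have hUd : U ⊆ Λ.paths (Λ.d a) := fun c hc => (hUs hc).2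
  obtain ⟨_, ⟨e, ⟨c, hc, b, hb, hce, hbe, -⟩, rfl⟩, hae, he⟩ :=
    hx _ (hΛ.image_remainder_minimalExtensions_mem_CE hUc hU hUd hK fun c hc => (hUs hc).1.1)
  -- The witness may extend a path `c ≠ a` near `a`; injectivity of `s` near `a` excludes this.
  obtain rfl : c = a := φ.injOn (hUs hc).1.2 haφ <| by
    rw [← hφ, s_eq_r_remainder hce (hUd hc), hae]
  rw [comp_remainder hce rfl] at he
  exact ⟨b, hb, x.ideal.lower hbe he⟩

theorem isBoundaryAt_iff (hΛ : Λ.CompactlyAligned) (ha : a ∈ x.ideal) :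
    IsBoundaryAt x a ↔ ∀ K, IsCompact K → UnavoidableNear K a → ∃ b ∈ K, b ∈ x.ideal := by
  refine ⟨fun hx K => hx.exists_mem_ideal hΛ, fun hx E hE => ?_⟩
  obtain ⟨C, hC, hCs, hCc⟩ := local_compact_nhds (Filter.inter_mem
    ((isOpen_paths (Λ.d a)).mem_nhds rfl) (Λ.continuous_s.continuousAt.preimage_mem_nhds hE.2.1))
  have hunavoidable : UnavoidableNear (Λ.setComp C E) a := by
    filter_upwards [hC] with c hc e hce
    exact exists_mem_setComp_hasCommonExt hE.2.2 hc (hCs hc).2 hce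
  obtain ⟨_, ⟨a', ha', b, hb, hab, rfl⟩, hmem⟩ := hx _ (isCompact_setComp hCc hE.1) hunavoidable
  have hd : Λ.d a' = Λ.d a := (hCs ha').1
  have ha'x : a' ∈ x.ideal := x.ideal.lower (le_comp a' b hab) hmem
  obtain rfl : a' = a := le_antisymm (le_of_mem_of_mem ha'x ha hd.le)
    (le_of_mem_of_mem ha ha'x hd.ge)
  exact ⟨b, hb, hab, hmem⟩

theorem IsBoundaryAt.of_le (hΛ : Λ.CompactlyAligned) (h : IsBoundaryAt x c) (hc : c ∈ x.ideal)
    (hac : a ≤ c) : IsBoundaryAt x a :=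
  (isBoundaryAt_iff hΛ (x.ideal.lower hac hc)).mpr fun K hK hKa =>
    (isBoundaryAt_iff hΛ hc).mp h K hK (hKa.of_le hac)

theorem IsBoundaryAt.of_shift (ha : a ∈ x.ideal) (h : Λ.s a = Λ.r b)
    (hb : IsBoundaryAt (x.shift (Λ.d a) (PathSpace.below_of_mem ha)) b) :
    IsBoundaryAt x (Λ.comp a b h) := by
  intro E hE
  obtain ⟨c, hc, hbc, hmem⟩ := hb E (Λ.s_comp a b h ▸ hE)
  refine ⟨c, hc, (Λ.s_comp a b h).trans hbc, ?_⟩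
  rw [Λ.assoc a b c h hbc]
  exact (PathSpace.mem_ideal_shift_iff ha _).mp hmem

theorem isBoundaryPath_of_shift (hΛ : Λ.CompactlyAligned) (ha : a ∈ x.ideal)
    (h : IsBoundaryPath (x.shift (Λ.d a) (PathSpace.below_of_mem ha))) : IsBoundaryPath x := by
  rw [isBoundaryPath_iff] at h ⊢
  intro c hc
  obtain ⟨_, he, ⟨b, hab, rfl⟩, hce⟩ := x.ideal.directed a ha c hc
  have hb := h b ((PathSpace.mem_ideal_shift_iff ha hab).mpr he)
  exact (hb.of_shift ha hab).of_le hΛ he hce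

end Boundary

section MaximalIdeals

variable {I : Order.Ideal Λ.Mor} {K : Set Λ.Mor}

theorem exists_ideal_ge_isMax {P : Type*} [Preorder P] (I : Order.Ideal P) :
    ∃ J, I ≤ J ∧ IsMax J := by
  refine zorn_le_nonempty_Ici₀ I (fun C _ hC y hy => ?_) I le_rfl
  have hideal : Order.IsIdeal (⋃₀ (SetLike.coe '' C) : Set P) :=
    Order.isIdeal_sUnion_of_isChain (Set.forall_mem_image.mpr fun J _ => J.isIdeal)
      (hC.image_of_map_rel _ _ SetLike.coe fun _ _ => id) ⟨_, y, hy, rfl⟩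
  exact ⟨hideal.toIdeal, fun J hJ => Set.subset_sUnion_of_mem (Set.mem_image_of_mem _ hJ)⟩

theorem CompactlyAligned.exists_ideal_ge_mem (hΛ : Λ.CompactlyAligned) {b : Λ.Mor}
    (h : ∀ c ∈ I, HasCommonExt c b) : ∃ J, I ≤ J ∧ b ∈ J := by
  choose f hcf hbf using fun c : I => h c c.2
  have : Nonempty I := I.nonempty.to_subtype
  have : IsDirectedOrder I := ⟨directedOn_iff_directed.mp I.directed⟩
  let 𝓤 : Ultrafilter I := Ultrafilter.of Filter.atTop
  have exists_limit (c : I) : ∃ e ∈ minimalExtensions {c.1} {b},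
      Filter.Tendsto (fun c' => initial (Λ.d c ⊔ Λ.d b) (f c')) 𝓤 (𝓝 e) := by
    refine (hΛ.isCompact_minimalExtensions isCompact_singleton
      isCompact_singleton).ultrafilter_le_nhds (𝓤.map _)
        (Filter.le_principal_iff.mpr (Filter.mem_map.mpr ?_))
    filter_upwards [(Filter.eventually_ge_atTop c).filter_mono (Ultrafilter.of_le _)] with c' hc'
    have hcc' : c.1 ≤ c'.1 := hc'
    exact initial_sup_mem_minimalExtensions rfl rfl (hcc'.trans (hcf c')) (hbf c')
  choose e he htendsto using exists_limit
  have hmono : Monotone e := fun c c' hcc' => by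
    have hlim := (continuous_initial (Λ.d c ⊔ Λ.d b)).continuousAt.tendsto.comp (htendsto c')
    simp only [Function.comp_def, initial_initial,
      inf_eq_left.mpr (sup_le_sup_right (d_mono hcc') (Λ.d b))] at hlim
    rw [tendsto_nhds_unique (htendsto c) hlim]
    exact initial_le _ _
  have hJ := isIdeal_lowerClosure (Set.range_nonempty e)
    hmono.directed_le.directedOn_range
  have le_limit (c : I) : c.1 ≤ e c ∧ b ≤ e c := by
    obtain ⟨_, rfl, _, rfl, hc, hb, -⟩ := he c
    exact ⟨hc, hb⟩
  refine ⟨hJ.toIdeal, fun c hc => ⟨_, ⟨⟨c, hc⟩, rfl⟩, (le_limit ⟨c, hc⟩).1⟩, ?_⟩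
  obtain ⟨c⟩ := ‹Nonempty I›
  exact ⟨_, ⟨c, rfl⟩, (le_limit c).2⟩

theorem CompactlyAligned.exists_forall_hasCommonExt (hΛ : Λ.CompactlyAligned) (hK : IsCompact K)
    (h : ∀ c ∈ I, ∃ b ∈ K, HasCommonExt c b) : ∃ b ∈ K, ∀ c ∈ I, HasCommonExt c b := by
  have : Nonempty I := I.nonempty.to_subtype
  let compatible (c : I) : Set Λ.Mor := K ∩ {b | HasCommonExt c.1 b}
  have hclosed (c : I) : IsClosed {b | HasCommonExt c.1 b} :=
    hΛ.isClosed_setOf_hasCommonExt.preimage (Continuous.prodMk_right c.1)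
  have hdirected : Directed (· ⊇ ·) compatible := fun c c' => by
    obtain ⟨e, he, hce, hce'⟩ := I.directed c.1 c.2 c'.1 c'.2
    exact ⟨⟨e, he⟩, fun b hb => ⟨hb.1, hb.2.imp fun _ hf => ⟨hce.trans hf.1, hf.2⟩⟩,
      fun b hb => ⟨hb.1, hb.2.imp fun _ hf => ⟨hce'.trans hf.1, hf.2⟩⟩⟩
  obtain ⟨b, hb⟩ := IsCompact.nonempty_iInter_of_directed_nonempty_isCompact_isClosed compatible
    hdirected (fun c => h c c.2) (fun c => hK.inter_right (hclosed c))
    fun c => hK.isClosed.inter (hclosed c)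
  rw [Set.mem_iInter] at hb
  exact ⟨b, (hb (Classical.arbitrary I)).1, fun c hc => (hb ⟨c, hc⟩).2⟩

theorem CompactlyAligned.exists_mem_of_isMax (hΛ : Λ.CompactlyAligned) (hI : IsMax I)
    (hK : IsCompact K) (h : ∀ c ∈ I, ∃ b ∈ K, HasCommonExt c b) : ∃ b ∈ K, b ∈ I := by
  obtain ⟨b, hb, hIb⟩ := hΛ.exists_forall_hasCommonExt hK h
  obtain ⟨J, hIJ, hbJ⟩ := hΛ.exists_ideal_ge_mem hIb
  exact ⟨b, hb, hI hIJ hbJ⟩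

theorem CompactlyAligned.isBoundaryPath_of_isMax_ideal (hΛ : Λ.CompactlyAligned)
    {x : Λ.PathSpace} (hx : IsMax x.ideal) : IsBoundaryPath x := by
  refine isBoundaryPath_iff.mpr fun a ha => (isBoundaryAt_iff hΛ ha).mpr fun K hK hKa =>
    hΛ.exists_mem_of_isMax hx hK fun c hc => ?_
  obtain ⟨e, -, hae, hce⟩ := x.ideal.directed a ha c hc
  obtain ⟨b, hb, f, hef, hbf⟩ := hKa.self_of_nhds e hae
  exact ⟨b, hb, f, hce.trans hef, hbf⟩

theorem CompactlyAligned.exists_isBoundaryPath (hΛ : Λ.CompactlyAligned) (w : Λ.Obj) :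
    ∃ x : Λ.PathSpace, IsBoundaryPath x ∧ x.range = w := by
  obtain ⟨J, hJ, hmax⟩ := exists_ideal_ge_isMax (Order.Ideal.principal (Λ.ident w))
  obtain ⟨x, rfl⟩ := PathSpace.ideal_surjective J
  refine ⟨x, hΛ.isBoundaryPath_of_isMax_ideal hmax, ?_⟩
  rw [← PathSpace.r_of_mem (Order.Ideal.principal_le_iff.mp hJ), Λ.r_ident]

end MaximalIdeals

section Aperiodicity

variable {x : Λ.PathSpace} {m p q t : Fin k → ℕ}

theorem PathSpace.degree_eq_top_or_eq_of_shift_eq {hp : Below p x.degree} {hq : Below q x.degree}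
    (h : x.shift p hp = x.shift q hq) (i : Fin k) : x.degree i = ⊤ ∨ p i = q i := by
  have hdeg : x.degree i - p i = x.degree i - q i := congrFun (congrArg PathSpace.degree h) i
  have hpi := hp i
  have hqi := hq i
  generalize x.degree i = n at *
  induction n using ENat.recTopCoe with
  | top => exact .inl rfl
  | coe n =>
    norm_cast at *
    omega

theorem PathSpace.shift_add_eq {hp : Below p x.degree} {hq : Below q x.degree}
    (h : x.shift p hp = x.shift q hq) (hpt : Below (p + t) x.degree)
    (hqt : Below (q + t) x.degree) :
    x.shift (p + t) hpt = x.shift (q + t) hqt := by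
  rw [← x.shift_shift p t hp (hp.sub_iff.mpr hpt), ← x.shift_shift q t hq (hq.sub_iff.mpr hqt)]
  exact shift_congr h rfl _ _

theorem Below.add_tsub_inf {n : Fin k → ℕ∞} (hm : Below m n) (hp : Below p n)
    (h : ∀ i, n i = ⊤ ∨ p i = q i) : Below (p + (m - p ⊓ q)) n := by
  intro i
  rcases h i with htop | hpq
  · simp [htop]
  · convert hm.sup hp i using 2
    simp only [Pi.add_apply, Pi.sub_apply, Pi.inf_apply, Pi.sup_apply]
    omega

theorem Aperiodic.shift_ne_of_le {hm : Below m x.degree} (h : Aperiodic (x.shift m hm))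
    (hmp : m ≤ p) (hmq : m ≤ q) (hp : Below p x.degree) (hq : Below q x.degree) (hpq : p ≠ q) :
    x.shift p hp ≠ x.shift q hq := by
  obtain ⟨p, rfl⟩ := exists_add_of_le hmp
  obtain ⟨q, rfl⟩ := exists_add_of_le hmq
  rw [← x.shift_shift m p hm (hm.sub_iff.mpr hp), ← x.shift_shift m q hm (hm.sub_iff.mpr hq)]
  exact h _ _ _ _ (ne_of_apply_ne (m + ·) hpq)

theorem aperiodic_of_shift (hm : Below m x.degree) (h : Aperiodic (x.shift m hm)) :
    Aperiodic x := by
  intro p q hp hq hpq heq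
  have htop := PathSpace.degree_eq_top_or_eq_of_shift_eq heq
  have hpt : Below (p + (m - p ⊓ q)) x.degree := hm.add_tsub_inf hp htop
  have hqt : Below (q + (m - p ⊓ q)) x.degree :=
    inf_comm q p ▸ hm.add_tsub_inf hq fun i => (htop i).imp_right Eq.symm
  have hmp : m ≤ p + (m - p ⊓ q) := le_add_tsub.trans (add_le_add_left inf_le_left _)
  have hmq : m ≤ q + (m - p ⊓ q) := le_add_tsub.trans (add_le_add_left inf_le_right _)
  exact h.shift_ne_of_le hmp hmq hpt hqt (add_left_injective _ |>.ne hpq)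
    (PathSpace.shift_add_eq heq hpt hqt)

theorem isotropy_eq_singleton_unit_iff (x : Λ.BoundaryPath) :
    {γ : GroupoidElement Λ.BoundaryPath | γ.range = x ∧ γ.source = x} = {GroupoidElement.unit x} ↔
      Aperiodic x.1 := by
  constructor
  · intro h p q hp hq hpq heq
    have hunit : (⟨x, x, ⟨fun i => (p i : ℤ) - q i, p, q, hp, hq, rfl, heq⟩⟩ :
        GroupoidElement Λ.BoundaryPath) = GroupoidElement.unit x := h.subset ⟨rfl, rfl⟩
    have hzero : (fun i => (p i : ℤ) - q i) = 0 :=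
      congrArg (fun γ : GroupoidElement Λ.BoundaryPath => γ.arrow.1) hunit
    exact hpq (funext fun i => Nat.cast_injective (sub_eq_zero.mp (congrFun hzero i)))
  · intro h
    refine subset_antisymm ?_ (Set.singleton_subset_iff.mpr ⟨rfl, rfl⟩)
    rintro ⟨y, z, ⟨n, p, q, hp, hq, rfl, heq⟩⟩ ⟨hy, hz⟩
    obtain rfl : y = x := hy
    obtain rfl : z = y := hz
    obtain rfl : p = q := by
      by_contra hpq
      exact h p q hp hq hpq heq
    have hzero : (fun i => (p i : ℤ) - p i) = 0 := funext fun i => sub_self _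
    simp only [hzero]
    rfl

end Aperiodicity

section PathSpaceTopology

variable {x : Λ.PathSpace}

/-- `Z(U)`, the set of paths with an initial segment in `U`. -/
def pathCylinder (U : Set Λ.Mor) : Set Λ.PathSpace := {x | ∃ a ∈ U, a ∈ x.ideal}

theorem pathCylinder_empty : pathCylinder (∅ : Set Λ.Mor) = ∅ :=
  Set.eq_empty_of_forall_notMem fun _ ⟨_, ha, _⟩ => ha

theorem pathCylinder_union (U V : Set Λ.Mor) :
    pathCylinder (U ∪ V) = pathCylinder U ∪ pathCylinder V := by
  ext x
  simp only [pathCylinder, Set.mem_union, or_and_right, exists_or, Set.mem_ofPred_eq]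

theorem pathCylinder_inter (U V : Set Λ.Mor) :
    pathCylinder U ∩ pathCylinder V =
      pathCylinder (upperClosure U ∩ upperClosure V : Set Λ.Mor) := by
  ext x
  constructor
  · rintro ⟨⟨a, haU, ha⟩, b, hbV, hb⟩
    obtain ⟨c, hc, hac, hbc⟩ := x.ideal.directed a ha b hb
    exact ⟨c, ⟨⟨a, haU, hac⟩, b, hbV, hbc⟩, hc⟩
  · rintro ⟨c, ⟨⟨a, haU, hac⟩, b, hbV, hbc⟩, hc⟩
    exact ⟨⟨a, haU, x.ideal.lower hac hc⟩, b, hbV, x.ideal.lower hbc hc⟩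

theorem pathCylinder_r_preimage (V : Set Λ.Obj) :
    pathCylinder (Λ.r ⁻¹' V) = {x : Λ.PathSpace | x.range ∈ V} := by
  ext x
  constructor
  · rintro ⟨a, haV, ha⟩
    exact (PathSpace.r_of_mem ha ▸ haV : x.range ∈ V)
  · intro hx
    exact ⟨_, Set.mem_preimage.mpr ((Λ.r_ident x.range).symm ▸ hx), x.ident_range_mem⟩

theorem unit_mem_cylinder_iff {F : Set (Λ.Mor × Λ.Mor)} {m : Fin k → ℤ} :
    GroupoidElement.unit x ∈ cylinder F m ↔ m = 0 ∧ x ∈ pathCylinder {a | (a, a) ∈ F} := by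
  constructor
  · rintro ⟨h, a, b, hab, hd, z, ha, hb⟩
    obtain rfl : m = 0 := h.symm
    have hd : Λ.d a = Λ.d b :=
      funext fun i => Nat.cast_injective (sub_eq_zero.mp (congrFun hd i))
    obtain ⟨ha, -⟩ := PathSpace.isConcat_iff.mp ha
    obtain ⟨hb, -⟩ := PathSpace.isConcat_iff.mp hb
    obtain rfl : a = b :=
      le_antisymm (le_of_mem_of_mem ha hb hd.le) (le_of_mem_of_mem hb ha hd.ge)
    exact ⟨rfl, a, hab, ha⟩
  · rintro ⟨rfl, a, haF, ha⟩
    have hconcat := PathSpace.isConcat_iff.mpr ⟨ha, rfl⟩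
    exact ⟨rfl, a, a, haF, funext fun i => sub_self _, _, hconcat, hconcat⟩

/-- The topology on the path space that makes `x ↦ (x, 0, x)` a homeomorphism onto the unit space of
the path groupoid. -/
instance pathSpaceTopology : TopologicalSpace Λ.PathSpace :=
  TopologicalSpace.induced GroupoidElement.unit pathGroupoidTopology

theorem isCompact_setOf_diag_mem {X : Type*} [TopologicalSpace X] [T2Space X] {F : Set (X × X)}
    (hF : IsCompact F) : IsCompact {a | (a, a) ∈ F} :=
  (hF.image continuous_fst).of_isClosed_subset
    (hF.isClosed.preimage (continuous_id.prodMk continuous_id)) fun _ ha => ⟨_, ha, rfl⟩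

theorem preimage_unit_cylinder_inter_compl (U V : Set Λ.Mor) (F : Set (Λ.Mor × Λ.Mor)) :
    GroupoidElement.unit ⁻¹' (cylinder (Λ.starS U V) 0 ∩ (cylinder F 0)ᶜ) =
      pathCylinder (U ∩ V) \ pathCylinder {a | (a, a) ∈ F} := by
  ext x
  have hdiag : {a | (a, a) ∈ Λ.starS U V} = U ∩ V := Set.ext fun a => and_iff_left rfl
  simp only [Set.mem_preimage, Set.mem_inter_iff, Set.mem_compl_iff, unit_mem_cylinder_iff,
    hdiag, true_and, Set.mem_sdiff]

theorem image_preimage_unit_generators :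
    Set.preimage (GroupoidElement.unit : Λ.PathSpace → GroupoidElement Λ.PathSpace) ''
        {S | ∃ (m : Fin k → ℤ) (U V : Set Λ.Mor) (F : Set (Λ.Mor × Λ.Mor)),
          IsOpen U ∧ IsOpen V ∧ F ⊆ Λ.sourcePairs ∧ IsCompact F ∧
            S = cylinder (Λ.starS U V) m ∩ (cylinder F m)ᶜ} =
      {S | ∃ U K : Set Λ.Mor, IsOpen U ∧ IsCompact K ∧ S = pathCylinder U \ pathCylinder K} := by
  ext S
  constructor
  · rintro ⟨_, ⟨m, U, V, F, hU, hV, -, hF, rfl⟩, rfl⟩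
    rcases eq_or_ne m 0 with rfl | hm
    · exact ⟨U ∩ V, {a | (a, a) ∈ F}, hU.inter hV, isCompact_setOf_diag_mem hF,
        preimage_unit_cylinder_inter_compl U V F⟩
    · refine ⟨∅, ∅, isOpen_empty, isCompact_empty, ?_⟩
      rw [sdiff_self]
      exact Set.eq_empty_of_forall_notMem fun x hx => hm (unit_mem_cylinder_iff.mp hx.1).1
  · rintro ⟨U, K, hU, hK, rfl⟩
    refine ⟨_, ⟨0, U, U, (fun a => (a, a)) '' K, hU, hU, ?_, hK.image (by fun_prop), rfl⟩, ?_⟩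
    · exact Set.image_subset_iff.mpr fun a _ => rfl
    · have hdiag : {a | (a, a) ∈ (fun a => (a, a)) '' K} = K :=
        Set.preimage_image_eq K fun a b h => congrArg Prod.fst h
      rw [preimage_unit_cylinder_inter_compl, Set.inter_self, hdiag]

theorem isTopologicalBasis_pathCylinder_sdiff :
    TopologicalSpace.IsTopologicalBasis {S : Set Λ.PathSpace |
      ∃ U K : Set Λ.Mor, IsOpen U ∧ IsCompact K ∧ S = pathCylinder U \ pathCylinder K} where
  exists_subset_inter := by
    rintro _ ⟨U, K, hU, hK, rfl⟩ _ ⟨V, L, hV, hL, rfl⟩ x hx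
    have hinter : (pathCylinder U \ pathCylinder K) ∩ (pathCylinder V \ pathCylinder L) =
        pathCylinder (upperClosure U ∩ upperClosure V : Set Λ.Mor) \ pathCylinder (K ∪ L) := by
      rw [← pathCylinder_inter, pathCylinder_union, Set.sdiff_eq, Set.sdiff_eq, Set.sdiff_eq,
        Set.inter_inter_inter_comm, Set.compl_union]
    exact ⟨_, ⟨_, _, (isOpen_upperClosure hU).inter (isOpen_upperClosure hV), hK.union hL, rfl⟩,
      hinter ▸ hx, hinter.ge⟩
  sUnion_eq := Set.eq_univ_of_forall fun x => by
    refine ⟨_, ⟨Set.univ, ∅, isOpen_univ, isCompact_empty, rfl⟩, ?_⟩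
    rw [pathCylinder_empty, Set.sdiff_empty]
    exact ⟨_, Set.mem_univ _, x.ident_range_mem⟩
  eq_generateFrom := by
    rw [← image_preimage_unit_generators, ← induced_generateFrom_eq]
    rfl

theorem isOpen_setOf_range_mem {V : Set Λ.Obj} (hV : IsOpen V) :
    IsOpen {x : Λ.PathSpace | x.range ∈ V} :=
  isTopologicalBasis_pathCylinder_sdiff.isOpen
    ⟨Λ.r ⁻¹' V, ∅, hV.preimage Λ.continuous_r, isCompact_empty, by
      rw [pathCylinder_empty, Set.sdiff_empty, pathCylinder_r_preimage]⟩

end PathSpaceTopology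

section EssentialFreeness

theorem essentiallyFree_iff_unit_mem_closure {C : Type*} [CategoryTheory.Groupoid C]
    [TopologicalSpace (GroupoidElement C)] :
    GroupoidElement.EssentiallyFree C ↔ ∀ x : C, GroupoidElement.unit x ∈
      closure (GroupoidElement.unit ''
        {x : C | {γ | γ.range = x ∧ γ.source = x} = {GroupoidElement.unit x}}) := by
  rw [GroupoidElement.EssentiallyFree, Subtype.dense_iff, GroupoidElement.units,
    Set.range_subset_iff]
  refine forall_congr' fun x => iff_of_eq (congrArg (GroupoidElement.unit x ∈ closure ·) ?_)
  ext γ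
  constructor
  · rintro ⟨⟨_, y, rfl⟩, hy, rfl⟩
    exact ⟨y, hy, rfl⟩
  · rintro ⟨y, hy, rfl⟩
    exact ⟨⟨_, y, rfl⟩, hy, rfl⟩

theorem essentiallyFree_iff_subset_closure :
    GroupoidElement.EssentiallyFree Λ.BoundaryPath ↔
      {x : Λ.PathSpace | IsBoundaryPath x} ⊆
        closure {x | IsBoundaryPath x ∧ Aperiodic x} := by
  have hincl : boundaryInclusion '' (GroupoidElement.unit ''
      {x : Λ.BoundaryPath | Aperiodic x.1}) =
        GroupoidElement.unit '' {x : Λ.PathSpace | IsBoundaryPath x ∧ Aperiodic x} := by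
    ext γ
    constructor
    · rintro ⟨_, ⟨x, hx, rfl⟩, rfl⟩
      exact ⟨x.1, ⟨x.2, hx⟩, rfl⟩
    · rintro ⟨x, ⟨hx, hxA⟩, rfl⟩
      exact ⟨_, ⟨⟨x, hx⟩, hxA, rfl⟩, rfl⟩
  have unit_mem_closure_iff (x : Λ.BoundaryPath) :
      GroupoidElement.unit x ∈ closure (GroupoidElement.unit '' {x | Aperiodic x.1}) ↔
        x.1 ∈ closure {x : Λ.PathSpace | IsBoundaryPath x ∧ Aperiodic x} :=
    (closure_induced (f := boundaryInclusion)).trans (hincl ▸ closure_induced.symm)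
  simp only [essentiallyFree_iff_unit_mem_closure, isotropy_eq_singleton_unit_iff]
  exact ⟨fun h x hx => (unit_mem_closure_iff ⟨x, hx⟩).mp (h _),
    fun h x => (unit_mem_closure_iff x).mpr (h x.2)⟩

theorem IsBoundaryPath.exists_isOpen_subset_upperClosure_forall_not_hasCommonExt
    (hΛ : Λ.CompactlyAligned) {x : Λ.PathSpace} (hx : IsBoundaryPath x) {U K : Set Λ.Mor}
    (hU : IsOpen U) (hK : IsCompact K) (hxU : x ∈ pathCylinder U) (hxK : x ∉ pathCylinder K) :
    ∃ O ⊆ (upperClosure U : Set Λ.Mor), IsOpen O ∧ O.Nonempty ∧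
      ∀ e ∈ O, ∀ b ∈ K, ¬ HasCommonExt e b := by
  obtain ⟨a, haU, ha⟩ := hxU
  obtain ⟨c, hcU, e, hce, he⟩ : ∃ c ∈ U, ∃ e, c ≤ e ∧ ∀ b ∈ K, ¬ HasCommonExt e b := by
    by_contra! hmeets
    refine hxK ((isBoundaryPath_iff.mp hx a ha).exists_mem_ideal hΛ hK ?_)
    filter_upwards [hU.mem_nhds haU] using hmeets
  refine ⟨upperClosure U ∩ {e | ∃ b ∈ K, HasCommonExt e b}ᶜ, Set.inter_subset_left,
    (isOpen_upperClosure hU).inter (hΛ.isClosed_setOf_exists_hasCommonExt hK).isOpen_compl,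
    ⟨e, ⟨c, hcU, hce⟩, fun ⟨b, hb, heb⟩ => he b hb heb⟩, fun e he b hb heb => he.2 ⟨b, hb, heb⟩⟩

theorem ConditionA.exists_mem_pathCylinder (hΛ : Λ.CompactlyAligned) (hA : Λ.ConditionA)
    {O : Set Λ.Mor} (hO : IsOpen O) (hne : O.Nonempty) :
    ∃ y ∈ pathCylinder O, IsBoundaryPath y ∧ Aperiodic y := by
  obtain ⟨z, hz, ⟨e, heO, hez⟩, hzA⟩ := hA (Λ.s '' O)
    (Λ.isLocalHomeomorph_s.isOpenMap O hO) (hne.image Λ.s)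
  obtain ⟨y, hy⟩ := PathSpace.exists_isConcat e z hez
  obtain ⟨hey, rfl⟩ := PathSpace.isConcat_iff.mp hy
  exact ⟨y, ⟨e, heO, hey⟩, isBoundaryPath_of_shift hΛ hey hz, aperiodic_of_shift _ hzA⟩

theorem ConditionA.subset_closure (hΛ : Λ.CompactlyAligned) (hA : Λ.ConditionA) :
    {x : Λ.PathSpace | IsBoundaryPath x} ⊆ closure {x | IsBoundaryPath x ∧ Aperiodic x} := by
  intro x hx
  rw [isTopologicalBasis_pathCylinder_sdiff.mem_closure_iff]
  rintro _ ⟨U, K, hU, hK, rfl⟩ ⟨hxU, hxK⟩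
  obtain ⟨O, hOU, hO, hne, hOK⟩ :=
    hx.exists_isOpen_subset_upperClosure_forall_not_hasCommonExt hΛ hU hK hxU hxK
  obtain ⟨y, ⟨e, heO, hey⟩, hy⟩ := hA.exists_mem_pathCylinder hΛ hO hne
  obtain ⟨a, haU, hae⟩ := hOU heO
  refine ⟨y, ⟨⟨a, haU, y.ideal.lower hae hey⟩, ?_⟩, hy⟩
  rintro ⟨b, hbK, hby⟩
  obtain ⟨f, -, hef, hbf⟩ := y.ideal.directed e hey b hby
  exact hOK e heO b hbK ⟨f, hef, hbf⟩

theorem conditionA_of_subset_closure (hΛ : Λ.CompactlyAligned)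
    (h : {x : Λ.PathSpace | IsBoundaryPath x} ⊆ closure {x | IsBoundaryPath x ∧ Aperiodic x}) :
    Λ.ConditionA := by
  rintro V hV ⟨w, hw⟩
  obtain ⟨x, hx, rfl⟩ := hΛ.exists_isBoundaryPath w
  obtain ⟨y, hyV, hy, hyA⟩ := mem_closure_iff.mp (h hx) _ (isOpen_setOf_range_mem hV) hw
  exact ⟨y, hy, hyV, hyA⟩

end EssentialFreeness

end TopologicalKGraph

theorem mainTheorem2 {k : ℕ} (Λ : TopologicalKGraph.{u, v} k) (hΛ : Λ.CompactlyAligned) :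
    GroupoidElement.EssentiallyFree Λ.BoundaryPath ↔ Λ.ConditionA :=
  TopologicalKGraph.essentiallyFree_iff_subset_closure.trans
    ⟨TopologicalKGraph.conditionA_of_subset_closure hΛ, fun hA => hA.subset_closure hΛ⟩
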